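/- Let $\mathbb K$ be an algebraically closed field (e.g. $\mathbb C$) and let $(E,A)$ be a system: two linear maps $E,A\colon M\to V$ between finite-dimensional $\mathbb K$-vector spaces. **Reduction and defects.** Put $V'=EM$ and $M'=A^{-1}V'$; the reduced system $(E,A)'$ consists of the restrictions of $E,A$ to $M'\to V'$. Iterating gives systems $(E^{(k)},A^{(k)})\colon M^{(k)}\to V^{(k)}$ ($k\ge0$), which become stationary; the stationary system (the iterate at the first $k$ with $(E,A)^{(k+1)}=(E,A)^{(k)}$) is written $(E^{(\infty)},A^{(\infty)})\colon M^{(\infty)}\to V^{(\infty)}$. Let $[E]\colon M/M'\to V'/V''$ and $[A]\colon M/M'\to V/V'$ be the induced maps, where $V''=EM'$, and $\alpha_1(E,A)=\dim\ker[E]$, $\beta_1^+(E,A)=\dim\operatorname{coker}[A]$. For $k\ge1$ put $\alpha_k(E,A)=\alpha_1((E,A)^{(k-1)})$, $\beta_k^+(E,A)=\beta_1^+((E,A)^{(k-1)})$ and $\beta_k^-(E,A)=\beta_k^+(E^{(\infty)*},A^{(\infty)*})$, where $*$ denotes the dual map. The dynamical part of $(E,A)$ is the system $(E^{(\infty)*(\infty)},A^{(\infty)*(\infty)})$,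 the stationary system of $(E^{(\infty)*},A^{(\infty)*})$; its domain and codomain are subspaces $M^{(\infty)*(\infty)}\subset (V^{(\infty)})^*$ and $V^{(\infty)*(\infty)}\subset (M^{(\infty)})^*$. **Decompositions.** A *reduction decomposition* of a system $(E,A)$ consists of subspaces $N^{(k)},C^{(k)},K^{(k)}\subset M$ and $W^{(k)},D^{(k)},Z^{(k)}\subset V$ ($k\ge1$) such that for all $k\ge1$: $M^{(k-1)}=M^{(k)}\oplus N^{(k)}$, $V^{(k-1)}=V^{(k)}\oplus W^{(k)}$, $N^{(k)}=C^{(k)}\oplus K^{(k)}$, $W^{(k)}=D^{(k)}\oplus Z^{(k)}$, $\ker E\cap N^{(k)}=K^{(k)}$, $EN^{(k)}=W^{(k+1)}$, $\ker A\cap N^{(k)}=0$, $AN^{(k)}=D^{(k)}$, $AM^{(k-1)}\cap Z^{(k)}=0$; together with bases of $C^{(k)},K^{(k)},D^{(k)},Z^{(k)}$ such that $A$ maps the basis of $C^{(k)}$ and $K^{(k)}$ together onto the basis of $D^{(k)}$, and $E$ maps the basis of $C^{(k)}$ onto the basis of $D^{(k+1)}$ and $Z^{(k+1)}$ together. A *full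 decomposition* of $(E,A)$ is a reduction decomposition of $(E,A)$ together with one of $(E^{(\infty)*},A^{(\infty)*})$. **Kronecker decompositions.** For $k\ge1$ let $L_k=(L_k^E,L_k^A)$ be the $k\times(k-1)$ matrices with ones exactly at the positions $(j,j)$, respectively $(j+1,j)$, $1\le j\le k-1$, and $N_k=(N_k^E,N_k^A)$ the $k\times k$ matrices where $N_k^E$ has ones exactly at the positions $(j,j+1)$ and $N_k^A=I$. A *Kronecker decomposition* of $(E,A)$ is a pair of bases of $M$ and $V$ in which $E$ and $A$ are $\operatorname{diag}(I,\bar E)$ and $\operatorname{diag}(J,\bar A)$, with $J$ a block diagonal matrix of Jordan blocks and $(\bar E,\bar A)$ a common block diagonal arrangement of blocks $N_k$, $L_k$ and $L_k^\top=((L_k^E)^\top,(L_k^A)^\top)$. **Theorem 8.5.** 1. Every system $(E,A)$ has a full decomposition. 2. From every full decomposition of $(E,A)$ one obtains, by regrouping its basis vectors, a Kronecker decomposition of $(E,A)$ which for every $k\ge1$ contains exactly $\alpha_k$ blocks $N_k$, $\beta_k^+$ blocks $L_k$ and $\beta_k^-$ blocks $L_k^\top$. More precisely: the basis vectors of $M$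 (of $V$) belonging to blocks $N_k$, $L_k$ are exactly those of the spaces $C^{(k)},K^{(k)}$ (of $D^{(k)},Z^{(k)}$) of the first reduction decomposition; the remaining basis vectors form bases of $M^{(\infty)}$ and $V^{(\infty)}$, and in the dual bases of $(M^{(\infty)})^*$ and $(V^{(\infty)})^*$ the elements belonging to blocks $L_k^\top$ are exactly the basis vectors of the second reduction decomposition (of its spaces $D^{(k)},Z^{(k)}$ and $C^{(k)},K^{(k)}$, respectively), while the elements belonging to the identity/Jordan block form bases of $V^{(\infty)*(\infty)}$ and $M^{(\infty)*(\infty)}$, respectively. Moreover the system $(I,J)$ is strictly equivalent to the dual $(E^{(\infty)*(\infty)*},A^{(\infty)*(\infty)*})$ of the dynamical part. 3. Two systems $(E_1,A_1)$ and $(E_2,A_2)$, $E_i,A_i\colon M_i\to V_i$, are strictly equivalent (i.e. $E_2=PE_1Q$, $A_2=PA_1Q$ for invertible linear $P\colon V_1\to V_2$, $Q\colon M_2\to M_1$) if and only if $\alpha_k$, $\beta_k^+$, $\beta_k^-$ agree for both systems for all $k\ge1$ and their dynamical parts are strictly equivalent. -/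

import Mathlib

/-!
Linear systems `(E, A)`, i.e. pairs of linear maps with the same domain and codomain, their
reduction, their defects, the adapted decompositions and the Kronecker decompositions.
-/

namespace Pencil

noncomputable section

open Module

/-! ### Reduction of a system -/

section Reduction

variable {𝕜 : Type*} [Field 𝕜] {M V : Type*} [AddCommGroup M] [Module 𝕜 M]
  [AddCommGroup V] [Module 𝕜 V]

/-- The reduced codomain `V' = E M`. -/
def reducedCodomain (E : M →ₗ[𝕜] V) : Submodule 𝕜 V := LinearMap.range E

/-- The reduced domain `M' = {x : A x ∈ V'}`. -/
def reducedDomain (E A : M →ₗ[𝕜] V) : Submodule 𝕜 M := (reducedCodomain E).comap A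

/-- A subsystem of `(E, A)`: a subspace of `M` and a subspace of `V` such that both `E` and `A`
send the first one to the second one. It carries the system made of the restrictions of `E`
and `A`. -/
@[ext]
structure Subsystem (E A : M →ₗ[𝕜] V) where
  dom : Submodule 𝕜 M
  cod : Submodule 𝕜 V
  E_mem : ∀ x ∈ dom, E x ∈ cod
  A_mem : ∀ x ∈ dom, A x ∈ cod

/-- The restriction of `E` to a subsystem. -/
def Subsystem.opE {E A : M →ₗ[𝕜] V} (S : Subsystem E A) : S.dom →ₗ[𝕜] S.cod :=
  E.restrict S.E_mem

/-- The restriction of `A` to a subsystem. -/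
def Subsystem.opA {E A : M →ₗ[𝕜] V} (S : Subsystem E A) : S.dom →ₗ[𝕜] S.cod :=
  A.restrict S.A_mem

/-- The reduced system of the system carried by a subsystem; its spaces, the reduced domain and
codomain of the restricted operators, are regarded as subspaces of `M` and `V`. -/
def Subsystem.reduce {E A : M →ₗ[𝕜] V} (S : Subsystem E A) : Subsystem E A where
  dom := (reducedDomain S.opE S.opA).map S.dom.subtype
  cod := (reducedCodomain S.opE).map S.cod.subtype
  E_mem := by
    rintro _ ⟨x, -, rfl⟩
    exact ⟨S.opE x, ⟨x, rfl⟩, rfl⟩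
  A_mem := by
    rintro _ ⟨x, hx, rfl⟩
    exact ⟨S.opA x, hx, rfl⟩

/-- The iterated reductions `(E, A)^(k)`, starting with `(E, A)` itself for `k = 0`. -/
def iter (E A : M →ₗ[𝕜] V) : ℕ → Subsystem E A
  | 0 => ⟨⊤, ⊤, fun _ _ => trivial, fun _ _ => trivial⟩
  | k + 1 => (iter E A k).reduce

/-- The index: the least number of reductions after which the system is totally reduced. -/
def index (E A : M →ₗ[𝕜] V) : ℕ := sInf {n | iter E A (n + 1) = iter E A n}

/-- The totally reduced system `(E^(∞), A^(∞))`. -/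
def totallyReduced (E A : M →ₗ[𝕜] V) : Subsystem E A := iter E A (index E A)

/-- `M^(∞)`. -/
abbrev domInf (E A : M →ₗ[𝕜] V) : Submodule 𝕜 M := (totallyReduced E A).dom

/-- `V^(∞)`. -/
abbrev codInf (E A : M →ₗ[𝕜] V) : Submodule 𝕜 V := (totallyReduced E A).cod

/-- `E^(∞)`. -/
abbrev EInf (E A : M →ₗ[𝕜] V) : domInf E A →ₗ[𝕜] codInf E A := (totallyReduced E A).opE

/-- `A^(∞)`. -/
abbrev AInf (E A : M →ₗ[𝕜] V) : domInf E A →ₗ[𝕜] codInf E A := (totallyReduced E A).opA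

/-- `E^(∞)*`, from the dual of `V^(∞)` to the dual of `M^(∞)`. -/
abbrev EInfDual (E A : M →ₗ[𝕜] V) : Dual 𝕜 (codInf E A) →ₗ[𝕜] Dual 𝕜 (domInf E A) :=
  (EInf E A).dualMap

/-- `A^(∞)*`, from the dual of `V^(∞)` to the dual of `M^(∞)`. -/
abbrev AInfDual (E A : M →ₗ[𝕜] V) : Dual 𝕜 (codInf E A) →ₗ[𝕜] Dual 𝕜 (domInf E A) :=
  (AInf E A).dualMap

/-- `M^(∞)*(∞)`, a subspace of the dual of `V^(∞)`. -/
abbrev dynDom (E A : M →ₗ[𝕜] V) : Submodule 𝕜 (Dual 𝕜 (codInf E A)) :=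
  domInf (EInfDual E A) (AInfDual E A)

/-- `V^(∞)*(∞)`, a subspace of the dual of `M^(∞)`. -/
abbrev dynCod (E A : M →ₗ[𝕜] V) : Submodule 𝕜 (Dual 𝕜 (domInf E A)) :=
  codInf (EInfDual E A) (AInfDual E A)

/-- `E^(∞)*(∞)`. -/
abbrev dynE (E A : M →ₗ[𝕜] V) : dynDom E A →ₗ[𝕜] dynCod E A :=
  EInf (EInfDual E A) (AInfDual E A)

/-- `A^(∞)*(∞)`. -/
abbrev dynA (E A : M →ₗ[𝕜] V) : dynDom E A →ₗ[𝕜] dynCod E A :=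
  AInf (EInfDual E A) (AInfDual E A)

end Reduction

/-! ### Defects -/

section Defects

variable {𝕜 : Type*} [Field 𝕜] {M V : Type*} [AddCommGroup M] [Module 𝕜 M]
  [AddCommGroup V] [Module 𝕜 V]

/-- The quotient operator `[A] : M / M' → V / V'`. -/
def quotA (E A : M →ₗ[𝕜] V) : (M ⧸ reducedDomain E A) →ₗ[𝕜] (V ⧸ reducedCodomain E) :=
  Submodule.mapQ (reducedDomain E A) (reducedCodomain E) A le_rfl

/-- The quotient operator `[E] : M / M' → V' / V''`, where `V'' = E M'`. -/
def quotE (E A : M →ₗ[𝕜] V) : (M ⧸ reducedDomain E A) →ₗ[𝕜]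
    (reducedCodomain E ⧸ ((reducedDomain E A).map E).comap (reducedCodomain E).subtype) :=
  Submodule.mapQ (reducedDomain E A) _ (LinearMap.rangeRestrict E) fun x hx => ⟨x, hx, rfl⟩

/-- The first constraint defect: the dimension of the kernel of `[E]`. -/
def alphaOne (E A : M →ₗ[𝕜] V) : ℕ := finrank 𝕜 (LinearMap.ker (quotE E A))

/-- The first observation defect: the dimension of the cokernel of `[A]`. -/
def betaPlusOne (E A : M →ₗ[𝕜] V) : ℕ :=
  finrank 𝕜 ((V ⧸ reducedCodomain E) ⧸ LinearMap.range (quotA E A))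

/-- The constraint defects `α_k`, meant for `k ≥ 1`. -/
def alpha (E A : M →ₗ[𝕜] V) (k : ℕ) : ℕ :=
  alphaOne (iter E A (k - 1)).opE (iter E A (k - 1)).opA

/-- The observation defects `β_k^+`, meant for `k ≥ 1`. -/
def betaPlus (E A : M →ₗ[𝕜] V) (k : ℕ) : ℕ :=
  betaPlusOne (iter E A (k - 1)).opE (iter E A (k - 1)).opA

/-- The control defects `β_k^-`, meant for `k ≥ 1`: the observation defects of the dual of the
totally reduced system. -/
def betaMinus (E A : M →ₗ[𝕜] V) (k : ℕ) : ℕ := betaPlus (EInfDual E A) (AInfDual E A) k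

end Defects

/-! ### Strict equivalence -/

/-- Strict equivalence of systems: `E₂ = P E₁ Q` and `A₂ = P A₁ Q` with `P`, `Q` invertible. -/
def StrictlyEquivalent {𝕜 : Type*} [Field 𝕜] {M₁ V₁ M₂ V₂ : Type*}
    [AddCommMonoid M₁] [Module 𝕜 M₁] [AddCommMonoid V₁] [Module 𝕜 V₁]
    [AddCommMonoid M₂] [Module 𝕜 M₂] [AddCommMonoid V₂] [Module 𝕜 V₂]
    (E₁ A₁ : M₁ →ₗ[𝕜] V₁) (E₂ A₂ : M₂ →ₗ[𝕜] V₂) : Prop :=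
  ∃ (P : V₁ ≃ₗ[𝕜] V₂) (Q : M₂ ≃ₗ[𝕜] M₁),
    E₂ = P.toLinearMap ∘ₗ E₁ ∘ₗ Q.toLinearMap ∧ A₂ = P.toLinearMap ∘ₗ A₁ ∘ₗ Q.toLinearMap

/-! ### Decompositions built from the reduction -/

section Decomposition

variable {𝕜 : Type*} [Field 𝕜] {M V : Type*} [AddCommGroup M] [Module 𝕜 M]
  [AddCommGroup V] [Module 𝕜 V]

/-- `S = S₁ ⊕ S₂` for subspaces of a given space. -/
def IsDirectSum (S S₁ S₂ : Submodule 𝕜 M) : Prop := Disjoint S₁ S₂ ∧ S₁ ⊔ S₂ = S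

/-- The set of vectors `b` is a basis of the subspace `S`. -/
def IsBasisOf (b : Set M) (S : Submodule 𝕜 M) : Prop :=
  LinearIndepOn 𝕜 id b ∧ Submodule.span 𝕜 b = S

/-- A decomposition of the system `(E, A)` adapted to its reduction. The families are indexed by
the integers `k ≥ 1`, and all conditions only concern such indices. -/
structure ReductionDecomposition (E A : M →ₗ[𝕜] V) where
  N : ℕ → Submodule 𝕜 M
  C : ℕ → Submodule 𝕜 M
  K : ℕ → Submodule 𝕜 M
  W : ℕ → Submodule 𝕜 V
  D : ℕ → Submodule 𝕜 V
  Z : ℕ → Submodule 𝕜 V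
  /-- `M^(k) = M^(k+1) ⊕ N^(k+1)` -/
  dom_eq : ∀ k, IsDirectSum (iter E A k).dom (iter E A (k + 1)).dom (N (k + 1))
  /-- `V^(k) = V^(k+1) ⊕ W^(k+1)` -/
  cod_eq : ∀ k, IsDirectSum (iter E A k).cod (iter E A (k + 1)).cod (W (k + 1))
  /-- `N^(k) = C^(k) ⊕ K^(k)` -/
  N_eq : ∀ k ≥ 1, IsDirectSum (N k) (C k) (K k)
  /-- `W^(k) = D^(k) ⊕ Z^(k)` -/
  W_eq : ∀ k ≥ 1, IsDirectSum (W k) (D k) (Z k)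
  /-- exactness of `0 → K^(k) → N^(k) → W^(k+1) → 0`, where the second map is `E` -/
  ker_E : ∀ k ≥ 1, LinearMap.ker E ⊓ N k = K k
  map_E : ∀ k ≥ 1, (N k).map E = W (k + 1)
  /-- exactness of `0 → N^(k) → W^(k) → Z^(k) → 0`, where the first map is `A` -/
  ker_A : ∀ k ≥ 1, Disjoint (LinearMap.ker A) (N k)
  map_A : ∀ k ≥ 1, (N k).map A = D k
  /-- `A M^(k-1) ∩ Z^(k) = 0` -/
  disjoint_Z : ∀ k, Disjoint ((iter E A k).dom.map A) (Z (k + 1))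
  basisC : ℕ → Set M
  basisK : ℕ → Set M
  basisD : ℕ → Set V
  basisZ : ℕ → Set V
  isBasis_C : ∀ k ≥ 1, IsBasisOf (basisC k) (C k)
  isBasis_K : ∀ k ≥ 1, IsBasisOf (basisK k) (K k)
  isBasis_D : ∀ k ≥ 1, IsBasisOf (basisD k) (D k)
  isBasis_Z : ∀ k ≥ 1, IsBasisOf (basisZ k) (Z k)
  /-- the basis of `D^(k)` is the image by `A` of the basis of `N^(k)` -/
  image_A : ∀ k ≥ 1, A '' (basisC k ∪ basisK k) = basisD k
  /-- the basis of `W^(k+1)` is the image by `E` of the basis of `C^(k)` -/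
  image_E : ∀ k ≥ 1, E '' basisC k = basisD (k + 1) ∪ basisZ (k + 1)

/-- The union over `k ≥ 1` of the bases of `C^(k)` and `K^(k)`. -/
def ReductionDecomposition.basisM {E A : M →ₗ[𝕜] V} (d : ReductionDecomposition E A) : Set M :=
  ⋃ k ≥ 1, d.basisC k ∪ d.basisK k

/-- The union over `k ≥ 1` of the bases of `D^(k)` and `Z^(k)`. -/
def ReductionDecomposition.basisV {E A : M →ₗ[𝕜] V} (d : ReductionDecomposition E A) : Set V :=
  ⋃ k ≥ 1, d.basisD k ∪ d.basisZ k

/-- The full decomposition: a decomposition of `(E, A)`, followed by a decomposition of the dual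
`(E^(∞)*, A^(∞)*)` of its totally reduced system. -/
structure FullDecomposition (E A : M →ₗ[𝕜] V) where
  first : ReductionDecomposition E A
  second : ReductionDecomposition (EInfDual E A) (AInfDual E A)

end Decomposition

/-! ### Kronecker blocks and Kronecker decompositions -/

section Kronecker

variable (𝕜 : Type*) [Field 𝕜]

/-- The `k × (k - 1)` block `L_k^E`, with ones at the positions `(j, j)`. -/
def blockLE (k : ℕ) : Matrix (Fin k) (Fin (k - 1)) 𝕜 :=
  Matrix.of fun i j => if (i : ℕ) = j then 1 else 0

/-- The `k × (k - 1)` block `L_k^A`, with ones at the positions `(j + 1, j)`. -/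
def blockLA (k : ℕ) : Matrix (Fin k) (Fin (k - 1)) 𝕜 :=
  Matrix.of fun i j => if (i : ℕ) = j + 1 then 1 else 0

/-- The `k × k` block `N_k^E`, with ones at the positions `(i, i + 1)`. -/
def blockNE (k : ℕ) : Matrix (Fin k) (Fin k) 𝕜 :=
  Matrix.of fun i j => if (i : ℕ) + 1 = j then 1 else 0

/-- The `k × k` block `N_k^A`, the identity. -/
def blockNA (k : ℕ) : Matrix (Fin k) (Fin k) 𝕜 := 1

variable {𝕜}

/-- The `k × k` Jordan block with eigenvalue `c`. -/
def jordanBlock (c : 𝕜) (k : ℕ) : Matrix (Fin k) (Fin k) 𝕜 := c • 1 + blockNE 𝕜 k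

variable (𝕜)

/-- The list of the blocks of a Kronecker form: the eigenvalues and sizes of the Jordan blocks,
and the integers `k` of the blocks `N_k`, `L_k` and `L_kᵀ`. -/
structure KroneckerBlocks where
  jordan : List (𝕜 × ℕ)
  nil : List ℕ
  L : List ℕ
  LT : List ℕ
  jordan_pos : ∀ p ∈ jordan, 1 ≤ p.2
  nil_pos : ∀ k ∈ nil, 1 ≤ k
  L_pos : ∀ k ∈ L, 1 ≤ k
  LT_pos : ∀ k ∈ LT, 1 ≤ k

variable {𝕜}

namespace KroneckerBlocks

variable (b : KroneckerBlocks 𝕜)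

/-- Rows and columns of the Jordan part. -/
abbrev DynIdx : Type := Σ i : Fin b.jordan.length, Fin (b.jordan.get i).2

/-- Rows and columns of the blocks `N_k`. -/
abbrev NilIdx : Type := Σ i : Fin b.nil.length, Fin (b.nil.get i)

/-- Rows of the blocks `L_k`. -/
abbrev LRow : Type := Σ i : Fin b.L.length, Fin (b.L.get i)

/-- Columns of the blocks `L_k`. -/
abbrev LCol : Type := Σ i : Fin b.L.length, Fin (b.L.get i - 1)

/-- Rows of the blocks `L_kᵀ`. -/
abbrev LTRow : Type := Σ i : Fin b.LT.length, Fin (b.LT.get i - 1)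

/-- Columns of the blocks `L_kᵀ`. -/
abbrev LTCol : Type := Σ i : Fin b.LT.length, Fin (b.LT.get i)

/-- All rows. -/
abbrev RowIdx : Type := b.DynIdx ⊕ (b.NilIdx ⊕ (b.LRow ⊕ b.LTRow))

/-- All columns. -/
abbrev ColIdx : Type := b.DynIdx ⊕ (b.NilIdx ⊕ (b.LCol ⊕ b.LTCol))

/-- `J`, the block diagonal matrix of the Jordan blocks. -/
def matJ : Matrix b.DynIdx b.DynIdx 𝕜 :=
  Matrix.blockDiagonal' fun i => jordanBlock (b.jordan.get i).1 (b.jordan.get i).2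

/-- `diag(I, N_k^E, …, L_k^E, …, (L_k^E)ᵀ, …)`. -/
def matE : Matrix b.RowIdx b.ColIdx 𝕜 :=
  Matrix.fromBlocks 1 0 0
    (Matrix.fromBlocks (Matrix.blockDiagonal' fun i => blockNE 𝕜 (b.nil.get i)) 0 0
      (Matrix.fromBlocks (Matrix.blockDiagonal' fun i => blockLE 𝕜 (b.L.get i)) 0 0
        (Matrix.blockDiagonal' fun i => (blockLE 𝕜 (b.LT.get i)).transpose)))

/-- `diag(J, N_k^A, …, L_k^A, …, (L_k^A)ᵀ, …)`. -/
def matA : Matrix b.RowIdx b.ColIdx 𝕜 :=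
  Matrix.fromBlocks b.matJ 0 0
    (Matrix.fromBlocks (Matrix.blockDiagonal' fun i => blockNA 𝕜 (b.nil.get i)) 0 0
      (Matrix.fromBlocks (Matrix.blockDiagonal' fun i => blockLA 𝕜 (b.L.get i)) 0 0
        (Matrix.blockDiagonal' fun i => (blockLA 𝕜 (b.LT.get i)).transpose)))

/-- The columns of the Jordan part and of the blocks `L_kᵀ` among all columns. -/
def colInf : b.DynIdx ⊕ b.LTCol → b.ColIdx :=
  Sum.elim Sum.inl fun i => Sum.inr (Sum.inr (Sum.inr i))

/-- The rows of the Jordan part and of the blocks `L_kᵀ` among all rows. -/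
def rowInf : b.DynIdx ⊕ b.LTRow → b.RowIdx :=
  Sum.elim Sum.inl fun i => Sum.inr (Sum.inr (Sum.inr i))

/-- The columns of the blocks `N_k` and `L_k` among all columns. -/
def colFirst : b.NilIdx ⊕ b.LCol → b.ColIdx :=
  Sum.elim (fun i => Sum.inr (Sum.inl i)) fun i => Sum.inr (Sum.inr (Sum.inl i))

/-- The rows of the blocks `N_k` and `L_k` among all rows. -/
def rowFirst : b.NilIdx ⊕ b.LRow → b.RowIdx :=
  Sum.elim (fun i => Sum.inr (Sum.inl i)) fun i => Sum.inr (Sum.inr (Sum.inl i))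

end KroneckerBlocks

variable {M V : Type*} [AddCommGroup M] [Module 𝕜 M] [AddCommGroup V] [Module 𝕜 V]

/-- A Kronecker decomposition of `(E, A)`: bases of `M` and `V` in which `E` and `A` have the
Kronecker form with the given blocks. -/
structure KroneckerDecomposition (E A : M →ₗ[𝕜] V) where
  blocks : KroneckerBlocks 𝕜
  basisM : Basis blocks.ColIdx 𝕜 M
  basisV : Basis blocks.RowIdx 𝕜 V
  toMatrix_E : LinearMap.toMatrix basisM basisV E = blocks.matE
  toMatrix_A : LinearMap.toMatrix basisM basisV A = blocks.matA

/-- The Kronecker decomposition is made of the basis vectors of the full decomposition `d`,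
arranged in another order:

* the vectors of the blocks `N_k` and `L_k` are those of the first decomposition;
* the vectors of the Jordan part and of the blocks `L_kᵀ` form bases of `M^(∞)` and `V^(∞)`, and
  they are obtained by transposition: in the dual bases, the covectors of the blocks `L_kᵀ` are the
  vectors of the second decomposition, and the covectors of the Jordan part form bases of
  `V^(∞)*(∞)` and `M^(∞)*(∞)`. -/
def KroneckerDecomposition.IsRegroupingOf {E A : M →ₗ[𝕜] V} (κ : KroneckerDecomposition E A)
    (d : FullDecomposition E A) : Prop :=
  Set.range (fun i => κ.basisM (κ.blocks.colFirst i)) = d.first.basisM ∧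
  Set.range (fun i => κ.basisV (κ.blocks.rowFirst i)) = d.first.basisV ∧
  (∃ bM : Basis (κ.blocks.DynIdx ⊕ κ.blocks.LTCol) 𝕜 (domInf E A),
    (∀ i, (bM i : M) = κ.basisM (κ.blocks.colInf i)) ∧
    Set.range (fun i => bM.coord (Sum.inr i)) = d.second.basisV ∧
    Submodule.span 𝕜 (Set.range fun i => bM.coord (Sum.inl i)) = dynCod E A) ∧
  (∃ bV : Basis (κ.blocks.DynIdx ⊕ κ.blocks.LTRow) 𝕜 (codInf E A),
    (∀ i, (bV i : V) = κ.basisV (κ.blocks.rowInf i)) ∧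
    Set.range (fun i => bV.coord (Sum.inr i)) = d.second.basisM ∧
    Submodule.span 𝕜 (Set.range fun i => bV.coord (Sum.inl i)) = dynDom E A)

end Kronecker

end

end Pencil

namespace Pencil

open Module

/-! ### Iterated reductions -/

section Iterates

variable {𝕜 : Type*} [Field 𝕜] {M V : Type*} [AddCommGroup M] [Module 𝕜 M]
  [AddCommGroup V] [Module 𝕜 V] {E A : M →ₗ[𝕜] V}

/-! Reduction removes a layer `N^(k)` from the domain and a layer `W^(k)` from the codomain at each
step. `E` maps `N^(k)` onto `W^(k+1)` with kernel `K^(k)`, and `A` maps `N^(k)` injectively into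
`W^(k)`, with complement `Z^(k)`. With adapted bases both maps match basis vectors injectively,
apart from the vectors of `K^(k)` that `E` kills. Alternately applying `A` and inverting `E` lowers
the level by one each time, so the basis vectors form chains that end at level 1. A chain started by
a basis vector of `K^(k)` is a block `N_k`, and one started by a basis vector of `Z^(k)` is a block
`L_k`. Counting dimensions gives `dim K^(k) = α_k` and `dim Z^(k) = β_k^+`.

Adapted bases exist because level `k` can be built from level `k + 1` by lifting a basis of
`W^(k+1)` through `E` (`exists_isLevel`); one starts beyond the index, where all layers vanish. The
combinatorics of chains is done for bare sets and maps (`IsChainSystem`), and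
`ReductionDecomposition.exists_bases` turns it into matrices.

On the stationary system `E` is surjective, so its dual has injective `E` and its reduction produces
only `L` blocks, which transpose to `L_kᵀ`. What is left has bijective `E`, hence amounts to one
endomorphism, put into Jordan form. The nilpotent case of the Jordan form is itself an instance of
the chain construction, for the system `(g, id)`.

For the classification, reduction commutes with strict equivalence, so all invariants agree for
equivalent systems. Conversely, both systems are equivalent to Kronecker forms with the same
singular and nilpotent blocks, while their Jordan parts are compared through the duals of the
dynamical parts; uniqueness of the Jordan form is never needed. -/

theorem Subsystem.reduce_cod (S : Subsystem E A) : S.reduce.cod = S.dom.map E := by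
  ext v
  simp only [Subsystem.reduce, reducedCodomain, Subsystem.opE, Submodule.mem_map,
    LinearMap.mem_range]
  constructor
  · rintro ⟨_, ⟨x, rfl⟩, rfl⟩
    exact ⟨x, x.2, rfl⟩
  · rintro ⟨x, hx, rfl⟩
    exact ⟨_, ⟨⟨x, hx⟩, rfl⟩, rfl⟩

theorem Subsystem.mem_reduce_dom (S : Subsystem E A) {x : M} :
    x ∈ S.reduce.dom ↔ x ∈ S.dom ∧ A x ∈ S.reduce.cod := by
  simp only [Subsystem.reduce, reducedDomain, reducedCodomain, Subsystem.opE, Subsystem.opA,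
    Submodule.mem_map, LinearMap.mem_range, Submodule.mem_comap]
  constructor
  · rintro ⟨x, ⟨y, hy⟩, rfl⟩
    exact ⟨x.2, _, ⟨y, hy⟩, rfl⟩
  · rintro ⟨hx, _, ⟨y, rfl⟩, h⟩
    exact ⟨⟨x, hx⟩, ⟨y, Subtype.ext h⟩, rfl⟩

@[simp] theorem iter_zero_dom : (iter E A 0).dom = ⊤ := rfl

@[simp] theorem iter_zero_cod : (iter E A 0).cod = ⊤ := rfl

theorem iter_succ_cod (k : ℕ) : (iter E A (k + 1)).cod = (iter E A k).dom.map E :=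
  (iter E A k).reduce_cod

theorem mem_iter_succ_dom {k : ℕ} {x : M} :
    x ∈ (iter E A (k + 1)).dom ↔ x ∈ (iter E A k).dom ∧ A x ∈ (iter E A (k + 1)).cod :=
  (iter E A k).mem_reduce_dom

theorem iter_succ_dom_le (k : ℕ) : (iter E A (k + 1)).dom ≤ (iter E A k).dom :=
  fun _ hx => (mem_iter_succ_dom.1 hx).1

theorem iter_succ_cod_le (k : ℕ) : (iter E A (k + 1)).cod ≤ (iter E A k).cod := by
  rw [iter_succ_cod]
  rintro _ ⟨x, hx, rfl⟩
  exact (iter E A k).E_mem x hx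

theorem iter_dom_antitone : Antitone fun k => (iter E A k).dom :=
  antitone_nat_of_succ_le iter_succ_dom_le

theorem iter_cod_antitone : Antitone fun k => (iter E A k).cod :=
  antitone_nat_of_succ_le iter_succ_cod_le

/-- Both descending chains of subspaces stabilise. This makes the infimum in `index` an attained
minimum instead of the default value `0` of `sInf ∅`. -/
theorem exists_iter_succ_eq [FiniteDimensional 𝕜 M] [FiniteDimensional 𝕜 V] (E A : M →ₗ[𝕜] V) :
    ∃ n, iter E A (n + 1) = iter E A n := by
  obtain ⟨n, hn⟩ := WellFoundedGT.monotone_chain_condition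
    (⟨fun k => OrderDual.toDual (iter E A k).dom, fun _ _ h => iter_dom_antitone h⟩ :
      ℕ →o (Submodule 𝕜 M)ᵒᵈ)
  obtain ⟨m, hm⟩ := WellFoundedGT.monotone_chain_condition
    (⟨fun k => OrderDual.toDual (iter E A k).cod, fun _ _ h => iter_cod_antitone h⟩ :
      ℕ →o (Submodule 𝕜 V)ᵒᵈ)
  refine ⟨max n m, Subsystem.ext ?_ ?_⟩
  · exact ((hn (max n m + 1) (by omega)).symm.trans (hn (max n m) (by omega)))
  · exact ((hm (max n m + 1) (by omega)).symm.trans (hm (max n m) (by omega)))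

theorem iter_eq_totallyReduced [FiniteDimensional 𝕜 M] [FiniteDimensional 𝕜 V]
    {k : ℕ} (hk : index E A ≤ k) : iter E A k = totallyReduced E A := by
  induction k, hk using Nat.le_induction with
  | base => rfl
  | succ k hk ih =>
    have h : iter E A (index E A + 1) = iter E A (index E A) :=
      Nat.sInf_mem (exists_iter_succ_eq E A)
    change (iter E A k).reduce = _
    rw [ih]
    exact h

theorem domInf_le_iter [FiniteDimensional 𝕜 M] [FiniteDimensional 𝕜 V] (k : ℕ) :
    domInf E A ≤ (iter E A k).dom := by
  have h := iter_dom_antitone (E := E) (A := A) (le_max_left k (index E A))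
  simp only [iter_eq_totallyReduced (le_max_right k (index E A))] at h
  exact h

theorem map_E_domInf [FiniteDimensional 𝕜 M] [FiniteDimensional 𝕜 V] (E A : M →ₗ[𝕜] V) :
    (domInf E A).map E = codInf E A := by
  have h := iter_succ_cod (E := E) (A := A) (index E A)
  rw [iter_eq_totallyReduced (Nat.le_succ _)] at h
  exact h.symm

theorem EInf_surjective [FiniteDimensional 𝕜 M] [FiniteDimensional 𝕜 V] (E A : M →ₗ[𝕜] V) :
    Function.Surjective (EInf E A) := by
  rintro ⟨v, hv⟩
  rw [← map_E_domInf] at hv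
  obtain ⟨x, hx, rfl⟩ := hv
  exact ⟨⟨x, hx⟩, rfl⟩

theorem Subsystem.finrank_reducedDomain (S : Subsystem E A) :
    finrank 𝕜 (reducedDomain S.opE S.opA) = finrank 𝕜 S.reduce.dom :=
  (Submodule.equivMapOfInjective S.dom.subtype S.dom.subtype_injective _).finrank_eq

theorem Subsystem.finrank_reducedCodomain (S : Subsystem E A) :
    finrank 𝕜 (reducedCodomain S.opE) = finrank 𝕜 S.reduce.cod :=
  (Submodule.equivMapOfInjective S.cod.subtype S.cod.subtype_injective _).finrank_eq

theorem Subsystem.finrank_map_reducedDomain (S : Subsystem E A) :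
    finrank 𝕜 ((reducedDomain S.opE S.opA).map S.opE) = finrank 𝕜 S.reduce.reduce.cod := by
  rw [Subsystem.reduce_cod]
  have h := (Submodule.equivMapOfInjective S.cod.subtype S.cod.subtype_injective
    ((reducedDomain S.opE S.opA).map S.opE)).finrank_eq
  rw [h, ← Submodule.map_comp]
  change _ = finrank 𝕜 (((reducedDomain S.opE S.opA).map S.dom.subtype).map E)
  rw [← Submodule.map_comp]
  rfl

end Iterates

/-! ### The defects as alternating sums of dimensions -/

section Dimensions

variable {𝕜 : Type*} [Field 𝕜] {M V : Type*} [AddCommGroup M] [Module 𝕜 M]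
  [AddCommGroup V] [Module 𝕜 V] [FiniteDimensional 𝕜 M] [FiniteDimensional 𝕜 V]

/-- Rank-nullity for `[E]`, which is onto because its target is a quotient of the range of `E`. The
identity is arranged so that no subtraction in `ℕ` occurs. -/
theorem alphaOne_add (E A : M →ₗ[𝕜] V) :
    alphaOne E A + finrank 𝕜 (reducedDomain E A) + finrank 𝕜 (reducedCodomain E) =
      finrank 𝕜 M + finrank 𝕜 ((reducedDomain E A).map E) := by
  have h1 := LinearMap.finrank_range_add_finrank_ker (quotE E A)
  have h2 : LinearMap.range (quotE E A) = ⊤ := by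
    rw [LinearMap.range_eq_top]
    rintro y
    obtain ⟨⟨_, x, rfl⟩, rfl⟩ := Submodule.Quotient.mk_surjective _ y
    exact ⟨Submodule.Quotient.mk x, rfl⟩
  rw [h2, finrank_top] at h1
  have h3 := Submodule.finrank_quotient_add_finrank (reducedDomain E A)
  have h4 := Submodule.finrank_quotient_add_finrank
    (((reducedDomain E A).map E).comap (reducedCodomain E).subtype)
  have h5 : finrank 𝕜 (((reducedDomain E A).map E).comap (reducedCodomain E).subtype) =
      finrank 𝕜 ((reducedDomain E A).map E) :=
    (Submodule.comapSubtypeEquivOfLe (LinearMap.map_le_range)).finrank_eq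
  unfold alphaOne
  omega

/-- Since `M'` is the whole preimage of `V'` under `A`, the map `[A]` is injective, and its cokernel
has the difference of the two quotient dimensions. -/
theorem betaPlusOne_add (E A : M →ₗ[𝕜] V) :
    betaPlusOne E A + finrank 𝕜 M + finrank 𝕜 (reducedCodomain E) =
      finrank 𝕜 V + finrank 𝕜 (reducedDomain E A) := by
  have h1 := LinearMap.finrank_range_of_inj (f := quotA E A) (by
    rw [← LinearMap.ker_eq_bot]
    refine (Submodule.ker_mapQ (reducedDomain E A) (reducedCodomain E) A le_rfl).trans ?_
    exact Submodule.mkQ_map_self (reducedDomain E A))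
  have h2 := Submodule.finrank_quotient_add_finrank (reducedDomain E A)
  have h3 := Submodule.finrank_quotient_add_finrank (reducedCodomain E)
  have h4 := Submodule.finrank_quotient_add_finrank (LinearMap.range (quotA E A))
  unfold betaPlusOne
  omega

variable (E A : M →ₗ[𝕜] V)

theorem alpha_succ_add (k : ℕ) :
    alpha E A (k + 1) + finrank 𝕜 (iter E A (k + 1)).dom + finrank 𝕜 (iter E A (k + 1)).cod =
      finrank 𝕜 (iter E A k).dom + finrank 𝕜 (iter E A (k + 2)).cod := by
  have h := alphaOne_add (iter E A k).opE (iter E A k).opA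
  rwa [Subsystem.finrank_reducedDomain, Subsystem.finrank_reducedCodomain,
    Subsystem.finrank_map_reducedDomain] at h

theorem betaPlus_succ_add (k : ℕ) :
    betaPlus E A (k + 1) + finrank 𝕜 (iter E A k).dom + finrank 𝕜 (iter E A (k + 1)).cod =
      finrank 𝕜 (iter E A k).cod + finrank 𝕜 (iter E A (k + 1)).dom := by
  have h := betaPlusOne_add (iter E A k).opE (iter E A k).opA
  rwa [Subsystem.finrank_reducedDomain, Subsystem.finrank_reducedCodomain] at h

end Dimensions

/-! ### Strict equivalence -/

section StrictEquivalence

variable {𝕜 : Type*} [Field 𝕜]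

section General

variable {M₁ V₁ M₂ V₂ M₃ V₃ M₄ V₄ : Type*}
  [AddCommGroup M₁] [Module 𝕜 M₁] [AddCommGroup V₁] [Module 𝕜 V₁]
  [AddCommGroup M₂] [Module 𝕜 M₂] [AddCommGroup V₂] [Module 𝕜 V₂]
  [AddCommGroup M₃] [Module 𝕜 M₃] [AddCommGroup V₃] [Module 𝕜 V₃]
  [AddCommGroup M₄] [Module 𝕜 M₄] [AddCommGroup V₄] [Module 𝕜 V₄]
  {E₁ A₁ : M₁ →ₗ[𝕜] V₁} {E₂ A₂ : M₂ →ₗ[𝕜] V₂} {E₃ A₃ : M₃ →ₗ[𝕜] V₃} {E₄ A₄ : M₄ →ₗ[𝕜] V₄}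

theorem StrictlyEquivalent.symm (h : StrictlyEquivalent E₁ A₁ E₂ A₂) :
    StrictlyEquivalent E₂ A₂ E₁ A₁ := by
  obtain ⟨P, Q, rfl, rfl⟩ := h
  exact ⟨P.symm, Q.symm, by ext; simp, by ext; simp⟩

theorem StrictlyEquivalent.trans (h : StrictlyEquivalent E₁ A₁ E₂ A₂)
    (h' : StrictlyEquivalent E₂ A₂ E₃ A₃) : StrictlyEquivalent E₁ A₁ E₃ A₃ := by
  obtain ⟨P, Q, rfl, rfl⟩ := h
  obtain ⟨P', Q', rfl, rfl⟩ := h'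
  exact ⟨P.trans P', Q'.trans Q, by ext; simp, by ext; simp⟩

theorem StrictlyEquivalent.dualMap (h : StrictlyEquivalent E₁ A₁ E₂ A₂) :
    StrictlyEquivalent E₁.dualMap A₁.dualMap E₂.dualMap A₂.dualMap := by
  obtain ⟨P, Q, rfl, rfl⟩ := h
  exact ⟨Q.dualMap, P.dualMap, by ext; simp, by ext; simp⟩

theorem StrictlyEquivalent.prodMap (h : StrictlyEquivalent E₁ A₁ E₂ A₂)
    (h' : StrictlyEquivalent E₃ A₃ E₄ A₄) :
    StrictlyEquivalent (E₁.prodMap E₃) (A₁.prodMap A₃) (E₂.prodMap E₄) (A₂.prodMap A₄) := by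
  obtain ⟨P, Q, rfl, rfl⟩ := h
  obtain ⟨P', Q', rfl, rfl⟩ := h'
  exact ⟨P.prodCongr P', Q.prodCongr Q', by ext <;> simp, by ext <;> simp⟩

end General

/-! ### Invariance of the reduction and of the defects -/

section Iterates

variable {M V M₂ V₂ : Type*}
  [AddCommGroup M] [Module 𝕜 M] [AddCommGroup V] [Module 𝕜 V]
  [AddCommGroup M₂] [Module 𝕜 M₂] [AddCommGroup V₂] [Module 𝕜 V₂]
  {E A : M →ₗ[𝕜] V} {E₂ A₂ : M₂ →ₗ[𝕜] V₂} {P : V ≃ₗ[𝕜] V₂} {Q : M₂ ≃ₗ[𝕜] M}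

/-- The two halves feed each other: the domains at level `k` determine the codomains at `k + 1`,
which then determine the domains at `k + 1`. They are transported in opposite directions because `Q`
goes from `M₂` to `M`. -/
theorem iter_conj (hE : E₂ = P.toLinearMap ∘ₗ E ∘ₗ Q.toLinearMap)
    (hA : A₂ = P.toLinearMap ∘ₗ A ∘ₗ Q.toLinearMap) (k : ℕ) :
    (iter E A k).dom = (iter E₂ A₂ k).dom.map Q.toLinearMap ∧
      (iter E A k).cod.map P.toLinearMap = (iter E₂ A₂ k).cod := by
  induction k with
  | zero => simp
  | succ k ih =>
    have h : (iter E A (k + 1)).cod.map P.toLinearMap = (iter E₂ A₂ (k + 1)).cod := by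
      rw [iter_succ_cod, iter_succ_cod, ih.1, ← Submodule.map_comp, ← Submodule.map_comp,
        LinearMap.comp_assoc, ← hE]
    refine ⟨?_, h⟩
    ext x
    obtain ⟨y, rfl⟩ := Q.surjective x
    rw [mem_iter_succ_dom, ih.1, Submodule.mem_map_equiv, Submodule.mem_map_equiv,
      LinearEquiv.symm_apply_apply, mem_iter_succ_dom, ← h, hA]
    simp [Submodule.mem_map_equiv]

theorem index_conj (hE : E₂ = P.toLinearMap ∘ₗ E ∘ₗ Q.toLinearMap)
    (hA : A₂ = P.toLinearMap ∘ₗ A ∘ₗ Q.toLinearMap) : index E A = index E₂ A₂ := by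
  have h : ∀ n, iter E A (n + 1) = iter E A n ↔ iter E₂ A₂ (n + 1) = iter E₂ A₂ n := by
    intro n
    rw [Subsystem.ext_iff, Subsystem.ext_iff, (iter_conj hE hA n).1, (iter_conj hE hA (n + 1)).1,
      ← (iter_conj hE hA n).2, ← (iter_conj hE hA (n + 1)).2,
      (Submodule.map_injective_of_injective Q.injective).eq_iff,
      (Submodule.map_injective_of_injective P.injective).eq_iff]
  unfold index
  simp only [h]

theorem StrictlyEquivalent.totallyReduced (h : StrictlyEquivalent E A E₂ A₂) :
    StrictlyEquivalent (EInf E A) (AInf E A) (EInf E₂ A₂) (AInf E₂ A₂) := by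
  obtain ⟨P, Q, hE, hA⟩ := h
  have hi := index_conj hE hA
  have h := iter_conj hE hA (index E A)
  have hM : (domInf E₂ A₂).map Q.toLinearMap = domInf E A := by
    unfold domInf Pencil.totallyReduced
    rw [← hi]
    exact h.1.symm
  have hV : (codInf E A).map P.toLinearMap = codInf E₂ A₂ := by
    unfold codInf Pencil.totallyReduced
    rw [← hi]
    exact h.2
  refine ⟨P.ofSubmodules _ _ hV, Q.ofSubmodules _ _ hM, ?_, ?_⟩
  · ext x
    simp [EInf, Subsystem.opE, hE]
  · ext x
    simp [AInf, Subsystem.opA, hA]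

theorem StrictlyEquivalent.finrank_iter (h : StrictlyEquivalent E A E₂ A₂) (k : ℕ) :
    finrank 𝕜 (iter E A k).dom = finrank 𝕜 (iter E₂ A₂ k).dom ∧
      finrank 𝕜 (iter E A k).cod = finrank 𝕜 (iter E₂ A₂ k).cod := by
  obtain ⟨P, Q, hE, hA⟩ := h
  have h := iter_conj hE hA k
  rw [h.1, ← h.2]
  exact ⟨Q.finrank_map_eq _, (P.finrank_map_eq _).symm⟩

variable [FiniteDimensional 𝕜 M] [FiniteDimensional 𝕜 V] [FiniteDimensional 𝕜 M₂]
  [FiniteDimensional 𝕜 V₂]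

theorem StrictlyEquivalent.alpha_succ_eq (h : StrictlyEquivalent E A E₂ A₂) (k : ℕ) :
    alpha E A (k + 1) = alpha E₂ A₂ (k + 1) := by
  have h1 := alpha_succ_add E A k
  have h2 := alpha_succ_add E₂ A₂ k
  have h3 := h.finrank_iter k
  have h4 := h.finrank_iter (k + 1)
  have h5 := h.finrank_iter (k + 2)
  omega

theorem StrictlyEquivalent.betaPlus_succ_eq (h : StrictlyEquivalent E A E₂ A₂) (k : ℕ) :
    betaPlus E A (k + 1) = betaPlus E₂ A₂ (k + 1) := by
  have h1 := betaPlus_succ_add E A k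
  have h2 := betaPlus_succ_add E₂ A₂ k
  have h3 := h.finrank_iter k
  have h4 := h.finrank_iter (k + 1)
  omega

theorem StrictlyEquivalent.betaMinus_succ_eq (h : StrictlyEquivalent E A E₂ A₂) (k : ℕ) :
    betaMinus E A (k + 1) = betaMinus E₂ A₂ (k + 1) :=
  h.totallyReduced.dualMap.betaPlus_succ_eq k

end Iterates

end StrictEquivalence

/-! ### Existence of decompositions adapted to the reduction -/

section Existence

variable {𝕜 : Type*} [Field 𝕜] {M V : Type*} [AddCommGroup M] [Module 𝕜 M]
  [AddCommGroup V] [Module 𝕜 V]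

theorem exists_isBasisOf (S : Submodule 𝕜 M) : ∃ b : Set M, IsBasisOf b S := by
  obtain ⟨b, -, hb, hli⟩ := exists_linearIndependent 𝕜 (S : Set M)
  exact ⟨b, hli, by rw [hb, Submodule.span_eq]⟩

theorem exists_isDirectSum {S T : Submodule 𝕜 M} (h : S ≤ T) :
    ∃ K, IsDirectSum T S K := by
  obtain ⟨K, hK⟩ := S.exists_isCompl
  refine ⟨K ⊓ T, hK.disjoint.mono_right inf_le_left, ?_⟩
  rw [← sup_inf_assoc_of_le K h, hK.sup_eq_top, top_inf_eq]

theorem IsBasisOf.union {b b' : Set M} {S S' : Submodule 𝕜 M} (h : IsBasisOf b S)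
    (h' : IsBasisOf b' S') (hd : Disjoint S S') : IsBasisOf (b ∪ b') (S ⊔ S') := by
  refine ⟨h.1.id_union h'.1 (by rwa [h.2, h'.2]), ?_⟩
  rw [Submodule.span_union, h.2, h'.2]

theorem IsBasisOf.image {b : Set M} {S : Submodule 𝕜 M} (h : IsBasisOf b S) (f : M →ₗ[𝕜] V)
    (hf : Disjoint (LinearMap.ker f) S) : IsBasisOf (f '' b) (S.map f) := by
  refine ⟨?_, by rw [← h.2, Submodule.map_span]⟩
  have := h.1.map_injOn f (by
    rw [← LinearMap.disjoint_ker_iff_injOn]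
    simpa [h.2] using hf.symm)
  exact this.id_image

theorem IsDirectSum.finrank_add [FiniteDimensional 𝕜 M] {S S₁ S₂ : Submodule 𝕜 M}
    (h : IsDirectSum S S₁ S₂) : finrank 𝕜 S₁ + finrank 𝕜 S₂ = finrank 𝕜 S := by
  rw [← Submodule.finrank_sup_add_finrank_inf_eq, h.1.eq_bot, finrank_bot, add_zero, h.2]

theorem IsDirectSum.isBasisOf_union {b b' : Set M} {S S₁ S₂ : Submodule 𝕜 M}
    (hS : IsDirectSum S S₁ S₂) (h : IsBasisOf b S₁) (h' : IsBasisOf b' S₂) :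
    IsBasisOf (b ∪ b') S :=
  hS.2 ▸ h.union h' hS.1

/-- A vector of `M^(k)` killed by `A` lies in `M^(k+1)`, since `0 ∈ V^(k+1)`; so every complement of
`M^(k+1)` avoids the kernel. -/
theorem disjoint_ker_A_of_disjoint {E A : M →ₗ[𝕜] V} {k : ℕ} {N : Submodule 𝕜 M}
    (hN : N ≤ (iter E A k).dom) (hd : Disjoint (iter E A (k + 1)).dom N) :
    Disjoint (LinearMap.ker A) N := by
  rw [Submodule.disjoint_def] at hd ⊢
  intro x hx hxN
  refine hd x (mem_iter_succ_dom.2 ⟨hN hxN, ?_⟩) hxN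
  rw [LinearMap.mem_ker.1 hx]
  exact zero_mem _

/-- The part of a reduction decomposition which concerns the spaces with superscript `k + 1`: the
spaces `N` and `W` are spanned by the bases of `C`, `K`, and by the image by `A` of these bases and
the basis of `Z`. -/
structure IsLevel (E A : M →ₗ[𝕜] V) (k : ℕ) (bC bK : Set M) (bZ : Set V) : Prop where
  indepC : LinearIndepOn 𝕜 id bC
  indepK : LinearIndepOn 𝕜 id bK
  indepZ : LinearIndepOn 𝕜 id bZ
  ker_E : Disjoint (LinearMap.ker E) (Submodule.span 𝕜 bC)
  K_le : Submodule.span 𝕜 bK ≤ LinearMap.ker E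
  dom_eq : IsDirectSum (iter E A k).dom (iter E A (k + 1)).dom
    (Submodule.span 𝕜 bC ⊔ Submodule.span 𝕜 bK)
  cod_eq : IsDirectSum (iter E A k).cod (iter E A (k + 1)).cod
    ((Submodule.span 𝕜 bC ⊔ Submodule.span 𝕜 bK).map A ⊔ Submodule.span 𝕜 bZ)
  disjoint_Z : Disjoint ((iter E A k).dom.map A) (Submodule.span 𝕜 bZ)

namespace IsLevel

variable {E A : M →ₗ[𝕜] V} {k : ℕ} {bC bK : Set M} {bZ : Set V}

theorem disjoint_CK (h : IsLevel E A k bC bK bZ) :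
    Disjoint (Submodule.span 𝕜 bC) (Submodule.span 𝕜 bK) :=
  (h.ker_E.mono_left h.K_le).symm

theorem N_le (h : IsLevel E A k bC bK bZ) :
    Submodule.span 𝕜 bC ⊔ Submodule.span 𝕜 bK ≤ (iter E A k).dom :=
  le_sup_right.trans h.dom_eq.2.le

theorem ker_A (h : IsLevel E A k bC bK bZ) :
    Disjoint (LinearMap.ker A) (Submodule.span 𝕜 bC ⊔ Submodule.span 𝕜 bK) :=
  disjoint_ker_A_of_disjoint h.N_le h.dom_eq.1

theorem disjoint_DZ (h : IsLevel E A k bC bK bZ) :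
    Disjoint ((Submodule.span 𝕜 bC ⊔ Submodule.span 𝕜 bK).map A) (Submodule.span 𝕜 bZ) :=
  h.disjoint_Z.mono_left (Submodule.map_mono h.N_le)

theorem isBasisOf_N (h : IsLevel E A k bC bK bZ) :
    IsBasisOf (bC ∪ bK) (Submodule.span 𝕜 bC ⊔ Submodule.span 𝕜 bK) :=
  IsBasisOf.union ⟨h.indepC, rfl⟩ ⟨h.indepK, rfl⟩ h.disjoint_CK

theorem isBasisOf_D (h : IsLevel E A k bC bK bZ) :
    IsBasisOf (A '' (bC ∪ bK)) ((Submodule.span 𝕜 bC ⊔ Submodule.span 𝕜 bK).map A) :=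
  h.isBasisOf_N.image A h.ker_A

theorem isBasisOf_W (h : IsLevel E A k bC bK bZ) :
    IsBasisOf (A '' (bC ∪ bK) ∪ bZ)
      ((Submodule.span 𝕜 bC ⊔ Submodule.span 𝕜 bK).map A ⊔ Submodule.span 𝕜 bZ) :=
  h.isBasisOf_D.union ⟨h.indepZ, rfl⟩ h.disjoint_DZ

theorem ker_E_inf (h : IsLevel E A k bC bK bZ) :
    LinearMap.ker E ⊓ (Submodule.span 𝕜 bC ⊔ Submodule.span 𝕜 bK) = Submodule.span 𝕜 bK := by
  rw [sup_comm, inf_comm, sup_inf_assoc_of_le _ h.K_le, inf_comm, h.ker_E.eq_bot, sup_bot_eq]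

theorem map_E (h : IsLevel E A k bC bK bZ) :
    (Submodule.span 𝕜 bC ⊔ Submodule.span 𝕜 bK).map E = Submodule.span 𝕜 (E '' bC) := by
  rw [Submodule.map_sup, Submodule.map_span, LinearMap.le_ker_iff_map.1 h.K_le, sup_bot_eq]

end IsLevel

/-- The inductive step of existence, going down in the level. Lifting the given basis `B` of the
next layer through `E` yields `C` and forces the compatibility `E '' bC = B`; `K` completes `ker E ∩
M^(k+1)` to `ker E ∩ M^(k)`; `Z` fills up what `V^(k+1)` and `A N` leave uncovered in `V^(k)`. -/
theorem exists_isLevel {E A : M →ₗ[𝕜] V} {k : ℕ} {B : Set V} {W : Submodule 𝕜 V}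
    (hB : IsBasisOf B W) (hW : IsDirectSum (iter E A (k + 1)).cod (iter E A (k + 2)).cod W) :
    ∃ bC bK bZ, IsLevel E A k bC bK bZ ∧ E '' bC = B := by
  have hlift : ∀ v : B, ∃ x ∈ (iter E A k).dom, E x = v := by
    intro v
    have hv : (v : V) ∈ (iter E A (k + 1)).cod :=
      hW.2.le (Submodule.mem_sup_right (hB.2 ▸ Submodule.subset_span v.2))
    rw [iter_succ_cod] at hv
    exact hv
  choose r hr hEr using hlift
  have hEC : E '' Set.range r = B := by
    rw [← Set.range_comp]
    simp [Function.comp_def, hEr]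
  have hliB : LinearIndependent 𝕜 (E ∘ r) := by
    have : E ∘ r = ((↑) : B → V) := funext hEr
    rw [this]
    exact hB.1
  have hC : LinearIndepOn 𝕜 id (Set.range r) := (hliB.of_comp E).linearIndepOn_id
  have hkerC : Disjoint (LinearMap.ker E) (Submodule.span 𝕜 (Set.range r)) := by
    rw [Submodule.disjoint_def]
    intro x hx hx'
    obtain ⟨l, rfl⟩ := (Finsupp.mem_span_range_iff_exists_finsupp).1 hx'
    have hl : l = 0 := by
      refine linearIndependent_iff.1 hliB l ?_
      simpa [Finsupp.linearCombination_apply, Finsupp.sum, map_sum] using hx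
    simp [hl]
  obtain ⟨K, hK⟩ := exists_isDirectSum
    (S := LinearMap.ker E ⊓ (iter E A (k + 1)).dom) (T := LinearMap.ker E ⊓ (iter E A k).dom)
    (inf_le_inf_left _ (iter_succ_dom_le k))
  obtain ⟨bK, hbK⟩ := exists_isBasisOf K
  have hKle : K ≤ LinearMap.ker E ⊓ (iter E A k).dom := le_sup_right.trans hK.2.le
  have hCle : Submodule.span 𝕜 (Set.range r) ≤ (iter E A k).dom :=
    Submodule.span_le.2 (Set.range_subset_iff.2 hr)
  have hCW : ∀ c ∈ Submodule.span 𝕜 (Set.range r), E c ∈ W := by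
    intro c hc
    rw [← hB.2, ← hEC, ← Submodule.map_span]
    exact Submodule.mem_map_of_mem hc
  have hN : IsDirectSum (iter E A k).dom (iter E A (k + 1)).dom
      (Submodule.span 𝕜 (Set.range r) ⊔ K) := by
    constructor
    -- For `c + κ` in `M^(k+1)`, the vector `E c` lies in both `V^(k+2)` and `W`, hence vanishes; so
    -- `c = 0`, and `κ` then lies in `ker E ∩ M^(k+1)`, which meets `K` trivially.
    · rw [Submodule.disjoint_def]
      intro x hx hx'
      obtain ⟨c, hc, κ, hκ, rfl⟩ := Submodule.mem_sup.1 hx'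
      have hEκ : E κ = 0 := (hKle hκ).1
      have h1 : E (c + κ) ∈ (iter E A (k + 2)).cod := by
        rw [iter_succ_cod]
        exact Submodule.mem_map_of_mem hx
      rw [map_add, hEκ, add_zero] at h1
      have h2 : c = 0 := Submodule.disjoint_def.1 hkerC c
        (Submodule.disjoint_def.1 hW.1 _ h1 (hCW c hc)) hc
      subst h2
      rw [zero_add] at hx ⊢
      exact Submodule.disjoint_def.1 hK.1 κ ⟨hEκ, hx⟩ hκ
    -- Split `E x` along `V^(k+1) = E M^(k+1) ⊕ E C` and lift both terms; the remaining error lies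
    -- in `ker E ∩ M^(k)`, which is split by the choice of `K`.
    · refine le_antisymm (sup_le (iter_succ_dom_le k)
        (sup_le hCle (hKle.trans inf_le_right))) fun x hx => ?_
      have h1 : E x ∈ (iter E A (k + 1)).cod := by
        rw [iter_succ_cod]
        exact Submodule.mem_map_of_mem hx
      rw [← hW.2] at h1
      obtain ⟨v, hv, w, hw, hvw⟩ := Submodule.mem_sup.1 h1
      rw [iter_succ_cod] at hv
      obtain ⟨m, hm, rfl⟩ := hv
      rw [← hB.2, ← hEC, ← Submodule.map_span] at hw
      obtain ⟨c, hc, rfl⟩ := hw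
      have h2 : x - m - c ∈ LinearMap.ker E ⊓ (iter E A k).dom := by
        refine ⟨by simp [← hvw], sub_mem (sub_mem hx (iter_succ_dom_le k hm)) (hCle hc)⟩
      rw [← hK.2] at h2
      obtain ⟨y, hy, κ, hκ, h3⟩ := Submodule.mem_sup.1 h2
      refine Submodule.mem_sup.2 ⟨m + y, add_mem hm hy.2, c + κ,
        add_mem (Submodule.mem_sup_left hc) (Submodule.mem_sup_right hκ), ?_⟩
      rw [eq_sub_iff_add_eq, eq_sub_iff_add_eq] at h3
      rw [← h3]
      abel
  have hNle := le_sup_right.trans hN.2.le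
  have hD : Disjoint (iter E A (k + 1)).cod ((Submodule.span 𝕜 (Set.range r) ⊔ K).map A) := by
    rw [Submodule.disjoint_def]
    rintro _ hv ⟨x, hx, rfl⟩
    rw [Submodule.disjoint_def.1 hN.1 x (mem_iter_succ_dom.2 ⟨hNle hx, hv⟩) hx, map_zero]
  obtain ⟨Z, hZ⟩ := exists_isDirectSum
    (S := (iter E A (k + 1)).cod ⊔ (Submodule.span 𝕜 (Set.range r) ⊔ K).map A)
    (T := (iter E A k).cod) (sup_le (iter_succ_cod_le k) (by
      rintro _ ⟨x, hx, rfl⟩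
      exact (iter E A k).A_mem x (hNle hx)))
  obtain ⟨bZ, hbZ⟩ := exists_isBasisOf Z
  -- `A` sends `M^(k+1)` into `V^(k+1)` by definition of the reduced domain, so avoiding `V^(k+1) +
  -- A N` is enough for `Z` to avoid `A M^(k)`.
  have hAM : (iter E A k).dom.map A ≤
      (iter E A (k + 1)).cod ⊔ (Submodule.span 𝕜 (Set.range r) ⊔ K).map A := by
    rw [← hN.2, Submodule.map_sup (p := (iter E A (k + 1)).dom)]
    refine sup_le_sup_right ?_ _
    rintro _ ⟨x, hx, rfl⟩
    exact (mem_iter_succ_dom.1 hx).2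
  refine ⟨Set.range r, bK, bZ, ⟨hC, hbK.1, hbZ.1, hkerC, hbK.2.le.trans (hKle.trans inf_le_left),
    by rwa [hbK.2], ⟨?_, ?_⟩, ?_⟩, hEC⟩
  · rw [hbK.2, hbZ.2]
    exact hD.disjoint_sup_right_of_disjoint_sup_left hZ.1
  · rw [hbK.2, hbZ.2, ← sup_assoc, hZ.2]
  · rw [hbZ.2]
    exact hZ.1.mono_left hAM

theorem nonempty_reductionDecomposition [FiniteDimensional 𝕜 M] [FiniteDimensional 𝕜 V]
    (E A : M →ₗ[𝕜] V) : Nonempty (ReductionDecomposition E A) := by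
  -- Descending induction from the index: `j` counts the levels already treated below it, and from
  -- the index upwards all bases are empty.
  have key : ∀ j : ℕ, ∃ (bC bK : ℕ → Set M) (bZ : ℕ → Set V), ∀ k ≥ index E A - j,
      IsLevel E A k (bC k) (bK k) (bZ k) ∧
        E '' bC k = A '' (bC (k + 1) ∪ bK (k + 1)) ∪ bZ (k + 1) := by
    intro j
    induction j with
    | zero =>
      refine ⟨fun _ => ∅, fun _ => ∅, fun _ => ∅, fun k hk => ⟨?_, by simp⟩⟩
      have h1 : iter E A (k + 1) = iter E A k := by
        rw [iter_eq_totallyReduced (by omega), iter_eq_totallyReduced (by omega)]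
      constructor <;> simp [IsDirectSum, h1, linearIndepOn_empty]
    | succ j ih =>
      -- Here the truncated differences for `j` and `j + 1` are both `0`, so nothing new has to be
      -- built.
      by_cases hj : index E A ≤ j
      · rwa [Nat.sub_eq_zero_of_le (by omega), ← Nat.sub_eq_zero_of_le hj]
      obtain ⟨bC, bK, bZ, h⟩ := ih
      obtain ⟨k, hk⟩ : ∃ k, index E A - j = k + 1 := ⟨index E A - j - 1, by omega⟩
      rw [hk] at h
      have hk' : index E A - (j + 1) = k := by omega
      rw [hk']
      obtain ⟨c, κ, z, hl, hE⟩ := exists_isLevel (h (k + 1) le_rfl).1.isBasisOf_W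
        (h (k + 1) le_rfl).1.cod_eq
      refine ⟨Function.update bC k c, Function.update bK k κ, Function.update bZ k z,
        fun l hl' => ?_⟩
      rcases eq_or_lt_of_le hl' with rfl | hlt
      · simpa using ⟨hl, hE⟩
      · have h1 : l ≠ k := by omega
        have h2 : l + 1 ≠ k := by omega
        simpa [h1, h2] using h l hlt
  obtain ⟨bC, bK, bZ, h⟩ := key (index E A)
  simp only [Nat.sub_self, ge_iff_le, Nat.zero_le, forall_const] at h
  refine ⟨{
    -- Superscripts start at `1` and the constructed levels at `0`; the values at `k = 0` are
    -- irrelevant.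
    N := fun k => Submodule.span 𝕜 (bC (k - 1)) ⊔ Submodule.span 𝕜 (bK (k - 1))
    C := fun k => Submodule.span 𝕜 (bC (k - 1))
    K := fun k => Submodule.span 𝕜 (bK (k - 1))
    W := fun k => (Submodule.span 𝕜 (bC (k - 1)) ⊔ Submodule.span 𝕜 (bK (k - 1))).map A ⊔
      Submodule.span 𝕜 (bZ (k - 1))
    D := fun k => (Submodule.span 𝕜 (bC (k - 1)) ⊔ Submodule.span 𝕜 (bK (k - 1))).map A
    Z := fun k => Submodule.span 𝕜 (bZ (k - 1))
    dom_eq := fun k => (h k).1.dom_eq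
    cod_eq := fun k => (h k).1.cod_eq
    N_eq := fun k _ => ⟨(h (k - 1)).1.disjoint_CK, rfl⟩
    W_eq := fun k _ => ⟨(h (k - 1)).1.disjoint_DZ, rfl⟩
    ker_E := fun k _ => (h (k - 1)).1.ker_E_inf
    map_E := fun k hk => by
      obtain ⟨k, rfl⟩ := Nat.exists_eq_add_of_le' hk
      simp only [Nat.add_sub_cancel]
      rw [(h k).1.map_E, (h k).2, (h (k + 1)).1.isBasisOf_W.2]
    ker_A := fun k _ => (h (k - 1)).1.ker_A
    map_A := fun k _ => rfl
    disjoint_Z := fun k => (h k).1.disjoint_Z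
    basisC := fun k => bC (k - 1)
    basisK := fun k => bK (k - 1)
    basisD := fun k => A '' (bC (k - 1) ∪ bK (k - 1))
    basisZ := fun k => bZ (k - 1)
    isBasis_C := fun k _ => ⟨(h (k - 1)).1.indepC, rfl⟩
    isBasis_K := fun k _ => ⟨(h (k - 1)).1.indepK, rfl⟩
    isBasis_D := fun k _ => (h (k - 1)).1.isBasisOf_D
    isBasis_Z := fun k _ => ⟨(h (k - 1)).1.indepZ, rfl⟩
    image_A := fun k _ => rfl
    image_E := fun k hk => by
      obtain ⟨k, rfl⟩ := Nat.exists_eq_add_of_le' hk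
      exact (h k).2 }⟩

end Existence

/-! ### Chains of basis vectors -/

section Chains

variable {M V : Type*}

/-- Two maps `E`, `A` which send vectors of level `k` injectively to vectors of the level `k + 1`,
resp. `k`: `A` sends the elements of `C k ∪ K k` to those of `D k`, and `E` sends the elements of
`C k` to those of `D (k + 1) ∪ Z (k + 1)`. -/
structure IsChainSystem (E A : M → V) (C K : ℕ → Set M) (D Z : ℕ → Set V) : Prop where
  image_A : ∀ k, A '' (C k ∪ K k) = D k
  image_E : ∀ k, E '' C k = D (k + 1) ∪ Z (k + 1)
  injOn_A : Set.InjOn A (⋃ k, C k ∪ K k)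
  injOn_E : Set.InjOn E (⋃ k, C k)
  disjoint_N : ∀ k l, k ≠ l → Disjoint (C k ∪ K k) (C l ∪ K l)
  disjoint_CK : ∀ k, Disjoint (C k) (K k)
  disjoint_W : ∀ k l, k ≠ l → Disjoint (D k ∪ Z k) (D l ∪ Z l)
  disjoint_DZ : ∀ k, Disjoint (D k) (Z k)
  eventually_empty : ∃ n, ∀ k ≥ n, C k ∪ K k = ∅

/-- The inverse of the injective map `E` on the union of the sets `C k`. -/
noncomputable def liftE (E : M → V) (C : ℕ → Set M) [Nonempty M] : V → M :=
  Function.invFunOn E (⋃ k, C k)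

/-- The columns of the chain of a block `N_k` which starts with `s`. -/
noncomputable def nilCol (E A : M → V) (C : ℕ → Set M) [Nonempty M] (s : M) (p : ℕ) : M :=
  (fun x => liftE E C (A x))^[p] s

/-- The rows of the chain of a block `L_k` which starts with `z`. -/
noncomputable def rowL (E A : M → V) (C : ℕ → Set M) [Nonempty M] (z : V) (p : ℕ) : V :=
  (fun v => A (liftE E C v))^[p] z

/-- The columns of the chain of a block `L_k` which starts with `z`. -/
noncomputable def colL (E A : M → V) (C : ℕ → Set M) [Nonempty M] (z : V) (p : ℕ) : M :=
  liftE E C (rowL E A C z p)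

namespace IsChainSystem

variable {E A : M → V} {C K : ℕ → Set M} {D Z : ℕ → Set V}

theorem disjoint_CK' (h : IsChainSystem E A C K D Z) (k l : ℕ) : Disjoint (C k) (K l) := by
  by_cases hkl : k = l
  · exact hkl ▸ h.disjoint_CK k
  · exact (h.disjoint_N k l hkl).mono Set.subset_union_left Set.subset_union_right

theorem disjoint_DZ' (h : IsChainSystem E A C K D Z) (k l : ℕ) : Disjoint (D k) (Z l) := by
  by_cases hkl : k = l
  · exact hkl ▸ h.disjoint_DZ k
  · exact (h.disjoint_W k l hkl).mono Set.subset_union_left Set.subset_union_right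

theorem eq_of_mem_K (h : IsChainSystem E A C K D Z) {k l : ℕ} {x : M} (hk : x ∈ K k)
    (hl : x ∈ K l) : k = l := by
  by_contra hkl
  exact Set.disjoint_left.1 (h.disjoint_N k l hkl) (Or.inr hk) (Or.inr hl)

theorem eq_of_mem_Z (h : IsChainSystem E A C K D Z) {k l : ℕ} {x : V} (hk : x ∈ Z k)
    (hl : x ∈ Z l) : k = l := by
  by_contra hkl
  exact Set.disjoint_left.1 (h.disjoint_W k l hkl) (Or.inr hk) (Or.inr hl)

theorem A_mem (h : IsChainSystem E A C K D Z) {k : ℕ} {x : M} (hx : x ∈ C k ∪ K k) :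
    A x ∈ D k :=
  h.image_A k ▸ Set.mem_image_of_mem A hx

theorem A_inj (h : IsChainSystem E A C K D Z) {k l : ℕ} {x y : M} (hx : x ∈ C k ∪ K k)
    (hy : y ∈ C l ∪ K l) (hxy : A x = A y) : x = y :=
  h.injOn_A (Set.mem_iUnion.2 ⟨k, hx⟩) (Set.mem_iUnion.2 ⟨l, hy⟩) hxy

variable [Nonempty M]

theorem liftE_apply (h : IsChainSystem E A C K D Z) {k : ℕ} {x : M} (hx : x ∈ C k) :
    liftE E C (E x) = x :=
  h.injOn_E.leftInvOn_invFunOn (Set.mem_iUnion.2 ⟨k, hx⟩)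

theorem liftE_mem (h : IsChainSystem E A C K D Z) {k : ℕ} {v : V}
    (hv : v ∈ D (k + 1) ∪ Z (k + 1)) : liftE E C v ∈ C k ∧ E (liftE E C v) = v := by
  rw [← h.image_E] at hv
  obtain ⟨x, hx, rfl⟩ := hv
  rw [h.liftE_apply hx]
  exact ⟨hx, rfl⟩

/-- Each step of a chain lowers the level by one, so writing the starting level as `p + l` places
position `p` at level `l` without subtraction. Membership at `p` and the relation leading to `p + 1`
are proved together, since inverting `E` at `p + 1` needs the former. -/
theorem nilCol_mem (h : IsChainSystem E A C K D Z) {s : M} (p : ℕ) :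
    (∀ l, s ∈ K (p + l) → nilCol E A C s p ∈ C l ∪ K l) ∧
      ∀ l, s ∈ K (p + 1 + l) → nilCol E A C s (p + 1) ∈ C l ∧
        E (nilCol E A C s (p + 1)) = A (nilCol E A C s p) := by
  have step : ∀ p, (∀ l, s ∈ K (p + l) → nilCol E A C s p ∈ C l ∪ K l) →
      ∀ l, s ∈ K (p + 1 + l) → nilCol E A C s (p + 1) ∈ C l ∧
        E (nilCol E A C s (p + 1)) = A (nilCol E A C s p) := by
    intro p hp l hl
    have h1 := h.A_mem (hp (l + 1) (by rwa [← add_assoc, add_right_comm]))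
    rw [nilCol, Function.iterate_succ_apply']
    exact h.liftE_mem (Or.inl h1)
  induction p with
  | zero =>
    have h0 : ∀ l, s ∈ K (0 + l) → nilCol E A C s 0 ∈ C l ∪ K l := fun l hl =>
      Or.inr (by rwa [zero_add] at hl)
    exact ⟨h0, step 0 h0⟩
  | succ p ih =>
    have h1 : ∀ l, s ∈ K (p + 1 + l) → nilCol E A C s (p + 1) ∈ C l ∪ K l :=
      fun l hl => Or.inl (ih.2 l hl).1
    exact ⟨h1, step _ h1⟩

theorem rowL_mem (h : IsChainSystem E A C K D Z) {z : V} (p : ℕ) :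
    (∀ l, z ∈ Z (p + l) → rowL E A C z p ∈ D l ∪ Z l) ∧
      ∀ l, z ∈ Z (p + 1 + l) → colL E A C z p ∈ C l ∧
        E (colL E A C z p) = rowL E A C z p ∧ A (colL E A C z p) = rowL E A C z (p + 1) := by
  have step : ∀ p, (∀ l, z ∈ Z (p + l) → rowL E A C z p ∈ D l ∪ Z l) →
      ∀ l, z ∈ Z (p + 1 + l) → colL E A C z p ∈ C l ∧
        E (colL E A C z p) = rowL E A C z p ∧ A (colL E A C z p) = rowL E A C z (p + 1) := by
    intro p hp l hl
    have h1 := h.liftE_mem (hp (l + 1) (by rwa [← add_assoc, add_right_comm]))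
    exact ⟨h1.1, h1.2, (Function.iterate_succ_apply' (fun v => A (liftE E C v)) p z).symm⟩
  induction p with
  | zero =>
    have h0 : ∀ l, z ∈ Z (0 + l) → rowL E A C z 0 ∈ D l ∪ Z l := fun l hl =>
      Or.inr (by rwa [zero_add] at hl)
    exact ⟨h0, step 0 h0⟩
  | succ p ih =>
    have h1 : ∀ l, z ∈ Z (p + 1 + l) → rowL E A C z (p + 1) ∈ D l ∪ Z l := by
      intro l hl
      obtain ⟨h1, -, h2⟩ := ih.2 l hl
      exact Or.inl (h2 ▸ h.A_mem (Or.inl h1))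
    exact ⟨h1, step _ h1⟩

/-- Walk both chains back simultaneously, by applying `E` and cancelling `A`. If one reaches its
start first, a vector of some `K` equals a later vector of the other chain, which lies in some `C`;
these sets are disjoint. -/
theorem nilCol_inj (h : IsChainSystem E A C K D Z) {s t : M} (p q : ℕ) (l m : ℕ)
    (hs : s ∈ K (p + l)) (ht : t ∈ K (q + m)) (hst : nilCol E A C s p = nilCol E A C t q) :
    s = t ∧ p = q := by
  induction p generalizing q l m with
  | zero =>
    cases q with
    | zero => exact ⟨hst, rfl⟩
    | succ q =>
      have h1 := ((h.nilCol_mem q).2 m ht).1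
      rw [← hst] at h1
      exact absurd hs (Set.disjoint_left.1 (h.disjoint_CK' _ _) h1)
  | succ p ih =>
    cases q with
    | zero =>
      have h1 := ((h.nilCol_mem p).2 l hs).1
      rw [hst] at h1
      exact absurd ht (Set.disjoint_left.1 (h.disjoint_CK' _ _) h1)
    | succ q =>
      have h1 := ((h.nilCol_mem p).2 l hs).2
      have h2 := ((h.nilCol_mem q).2 m ht).2
      have hs' : s ∈ K (p + (l + 1)) := by rwa [← add_assoc, add_right_comm]
      have ht' : t ∈ K (q + (m + 1)) := by rwa [← add_assoc, add_right_comm]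
      have h3 := ih q _ _ hs' ht' (h.A_inj ((h.nilCol_mem p).1 _ hs') ((h.nilCol_mem q).1 _ ht')
        (by rw [← h1, ← h2, hst]))
      exact ⟨h3.1, congrArg _ h3.2⟩

/-- The same backward walk, where the starts lie in some `Z` and all later rows in some `D`. -/
theorem rowL_inj (h : IsChainSystem E A C K D Z) {s t : V} (p q : ℕ) (l m : ℕ)
    (hs : s ∈ Z (p + l)) (ht : t ∈ Z (q + m)) (hst : rowL E A C s p = rowL E A C t q) :
    s = t ∧ p = q := by
  induction p generalizing q l m with
  | zero =>
    cases q with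
    | zero => exact ⟨hst, rfl⟩
    | succ q =>
      obtain ⟨h1, -, h2⟩ := (h.rowL_mem q).2 m ht
      have h3 := h.A_mem (Or.inl h1)
      rw [h2, ← hst] at h3
      exact absurd hs (Set.disjoint_left.1 (h.disjoint_DZ' _ _) h3)
  | succ p ih =>
    cases q with
    | zero =>
      obtain ⟨h1, -, h2⟩ := (h.rowL_mem p).2 l hs
      have h3 := h.A_mem (Or.inl h1)
      rw [h2, hst] at h3
      exact absurd ht (Set.disjoint_left.1 (h.disjoint_DZ' _ _) h3)
    | succ q =>
      obtain ⟨h1, h2, h3⟩ := (h.rowL_mem p).2 l hs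
      obtain ⟨h1', h2', h3'⟩ := (h.rowL_mem q).2 m ht
      have h4 := ih q (l + 1) (m + 1) (by rwa [← add_assoc, add_right_comm])
        (by rwa [← add_assoc, add_right_comm])
        (by rw [← h2, ← h2', h.A_inj (Or.inl h1) (Or.inl h1') (by rw [h3, h3', hst])])
      exact ⟨h4.1, congrArg _ h4.2⟩

theorem colL_inj (h : IsChainSystem E A C K D Z) {s t : V} (p q : ℕ) (l m : ℕ)
    (hs : s ∈ Z (p + 1 + l)) (ht : t ∈ Z (q + 1 + m)) (hst : colL E A C s p = colL E A C t q) :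
    s = t ∧ p = q := by
  obtain ⟨-, h2, -⟩ := (h.rowL_mem p).2 l hs
  obtain ⟨-, h2', -⟩ := (h.rowL_mem q).2 m ht
  exact h.rowL_inj p q (l + 1) (m + 1) (by rwa [← add_assoc, add_right_comm])
    (by rwa [← add_assoc, add_right_comm]) (by rw [← h2, ← h2', hst])

/-- Walking back from a common vector, either the nilpotent chain reaches its start in `K` while the
other column lies in `C`, or the other chain reaches its start in `Z` while the corresponding row of
the nilpotent chain lies in `D`. -/
theorem nilCol_ne_colL (h : IsChainSystem E A C K D Z) {s : M} {t : V} (p q : ℕ) (l m : ℕ)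
    (hs : s ∈ K (p + l)) (ht : t ∈ Z (q + 1 + m)) : nilCol E A C s p ≠ colL E A C t q := by
  intro hst
  induction p generalizing q l m with
  | zero =>
    have h1 := ((h.rowL_mem q).2 m ht).1
    rw [← hst] at h1
    exact absurd hs (Set.disjoint_left.1 (h.disjoint_CK' _ _) h1)
  | succ p ih =>
    have hs' : s ∈ K (p + (l + 1)) := by rwa [← add_assoc, add_right_comm]
    have hp := (h.nilCol_mem p).1 _ hs'
    have h1 := ((h.nilCol_mem p).2 l hs).2
    have h2 := ((h.rowL_mem q).2 m ht).2.1
    rw [hst, h2] at h1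
    cases q with
    | zero =>
      have h3 := h.A_mem hp
      rw [← h1] at h3
      exact absurd ht (Set.disjoint_left.1 (h.disjoint_DZ' _ _) h3)
    | succ q =>
      have ht' : t ∈ Z (q + 1 + (m + 1)) := by rwa [← add_assoc, add_right_comm]
      obtain ⟨h3, -, h4⟩ := (h.rowL_mem q).2 _ ht'
      exact ih q _ _ hs' ht' (h.A_inj hp (Or.inl h3) (by rw [h4, h1]))

/-- Going backwards through `E` and then `A⁻¹` raises the level; as high levels are empty, one must
meet `K` or `Z`, where a chain starts. -/
theorem exists_col (h : IsChainSystem E A C K D Z) {m : ℕ} {x : M} (hx : x ∈ C m ∪ K m) :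
    (∃ p, ∃ s ∈ K (p + m), nilCol E A C s p = x) ∨
      ∃ p, ∃ z ∈ Z (p + 1 + m), colL E A C z p = x := by
  obtain ⟨n, hn⟩ := h.eventually_empty
  -- `j` bounds the number of levels left before the empty ones, and is the induction variable.
  obtain ⟨j, hj⟩ : ∃ j, j + m ≥ n := ⟨n, by omega⟩
  induction j generalizing m x with
  | zero =>
    rw [zero_add] at hj
    simp [hn m hj] at hx
  | succ j ih =>
    rcases hx with hx | hx
    · have h1 : E x ∈ D (m + 1) ∪ Z (m + 1) := h.image_E m ▸ Set.mem_image_of_mem E hx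
      rcases h1 with h1 | h1
      · rw [← h.image_A] at h1
        obtain ⟨y, hy, hyx⟩ := h1
        rcases ih hy (by omega) with ⟨p, s, hs, hsy⟩ | ⟨p, z, hz, hzy⟩
        · refine Or.inl ⟨p + 1, s, by rwa [add_assoc, add_comm 1], ?_⟩
          rw [nilCol, Function.iterate_succ_apply']
          change liftE E C (A (nilCol E A C s p)) = x
          rw [hsy, hyx, h.liftE_apply hx]
        · refine Or.inr ⟨p + 1, z, by rwa [add_assoc _ 1 m, add_comm 1 m], ?_⟩
          rw [colL, ← ((h.rowL_mem p).2 _ hz).2.2, hzy, hyx, h.liftE_apply hx]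
      · exact Or.inr ⟨0, E x, by rwa [zero_add, add_comm], h.liftE_apply hx⟩
    · exact Or.inl ⟨0, x, by rwa [zero_add], rfl⟩

theorem exists_row (h : IsChainSystem E A C K D Z) {m : ℕ} {v : V} (hv : v ∈ D m ∪ Z m) :
    (∃ p, ∃ s ∈ K (p + m), A (nilCol E A C s p) = v) ∨
      ∃ p, ∃ z ∈ Z (p + m), rowL E A C z p = v := by
  rcases hv with hv | hv
  · rw [← h.image_A] at hv
    obtain ⟨x, hx, rfl⟩ := hv
    rcases h.exists_col hx with ⟨p, s, hs, rfl⟩ | ⟨p, z, hz, rfl⟩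
    · exact Or.inl ⟨p, s, hs, rfl⟩
    · exact Or.inr ⟨p + 1, z, hz, ((h.rowL_mem p).2 _ hz).2.2.symm⟩
  · exact Or.inr ⟨0, v, by rwa [zero_add], rfl⟩

end IsChainSystem

/-- All the columns of the chains, indexed by the starting point and the position. -/
noncomputable def chainCol (E A : M → V) (C K : ℕ → Set M) (Z : ℕ → Set V) [Nonempty M] :
    (Σ i : (Σ k, K k), Fin (i.1 + 1)) ⊕ (Σ i : (Σ k, Z k), Fin i.1) → M :=
  Sum.elim (fun j => nilCol E A C j.1.2 j.2) fun j => colL E A C j.1.2 j.2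

/-- All the rows of the chains, indexed by the starting point and the position. -/
noncomputable def chainRow (E A : M → V) (C K : ℕ → Set M) (Z : ℕ → Set V) [Nonempty M] :
    (Σ i : (Σ k, K k), Fin (i.1 + 1)) ⊕ (Σ i : (Σ k, Z k), Fin (i.1 + 1)) → V :=
  Sum.elim (fun j => A (nilCol E A C j.1.2 j.2)) fun j => rowL E A C j.1.2 j.2

namespace IsChainSystem

variable {E A : M → V} {C K : ℕ → Set M} {D Z : ℕ → Set V} [Nonempty M]

theorem chainCol_injective (h : IsChainSystem E A C K D Z) :
    Function.Injective (chainCol E A C K Z) := by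
  rintro (⟨⟨k, s, hs⟩, p, hp⟩ | ⟨⟨k, s, hs⟩, p, hp⟩)
    (⟨⟨l, t, ht⟩, q, hq⟩ | ⟨⟨l, t, ht⟩, q, hq⟩) hst
  · obtain ⟨a, rfl⟩ := Nat.exists_eq_add_of_le (Nat.lt_succ_iff.1 hp)
    obtain ⟨b, rfl⟩ := Nat.exists_eq_add_of_le (Nat.lt_succ_iff.1 hq)
    obtain ⟨rfl, rfl⟩ := h.nilCol_inj p q a b hs ht hst
    obtain rfl := Nat.add_left_cancel (h.eq_of_mem_K hs ht)
    rfl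
  · obtain ⟨a, rfl⟩ := Nat.exists_eq_add_of_le (Nat.lt_succ_iff.1 hp)
    obtain ⟨b, rfl⟩ := Nat.exists_eq_add_of_le (Nat.succ_le_iff.2 hq)
    exact absurd hst (h.nilCol_ne_colL p q a b hs ht)
  · obtain ⟨a, rfl⟩ := Nat.exists_eq_add_of_le (Nat.succ_le_iff.2 hp)
    obtain ⟨b, rfl⟩ := Nat.exists_eq_add_of_le (Nat.lt_succ_iff.1 hq)
    exact absurd hst.symm (h.nilCol_ne_colL q p b a ht hs)
  · obtain ⟨a, rfl⟩ := Nat.exists_eq_add_of_le (Nat.succ_le_iff.2 hp)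
    obtain ⟨b, rfl⟩ := Nat.exists_eq_add_of_le (Nat.succ_le_iff.2 hq)
    obtain ⟨rfl, rfl⟩ := h.colL_inj p q a b hs ht hst
    obtain rfl := Nat.add_left_cancel (h.eq_of_mem_Z hs ht)
    rfl

theorem rowL_ne_A_nilCol (h : IsChainSystem E A C K D Z) {s : M} {t : V} (p q : ℕ) (l m : ℕ)
    (hs : s ∈ K (p + l)) (ht : t ∈ Z (q + m)) : A (nilCol E A C s p) ≠ rowL E A C t q := by
  intro hst
  have hp := (h.nilCol_mem p).1 _ hs
  cases q with
  | zero =>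
    have h1 := h.A_mem hp
    rw [hst] at h1
    exact absurd ht (Set.disjoint_left.1 (h.disjoint_DZ' _ _) h1)
  | succ q =>
    obtain ⟨h1, -, h2⟩ := (h.rowL_mem q).2 m ht
    exact h.nilCol_ne_colL p q l m hs ht (h.A_inj hp (Or.inl h1) (by rw [hst, h2]))

theorem chainRow_injective (h : IsChainSystem E A C K D Z) :
    Function.Injective (chainRow E A C K Z) := by
  rintro (⟨⟨k, s, hs⟩, p, hp⟩ | ⟨⟨k, s, hs⟩, p, hp⟩)
    (⟨⟨l, t, ht⟩, q, hq⟩ | ⟨⟨l, t, ht⟩, q, hq⟩) hst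
  all_goals
    obtain ⟨a, rfl⟩ := Nat.exists_eq_add_of_le (Nat.lt_succ_iff.1 hp)
    obtain ⟨b, rfl⟩ := Nat.exists_eq_add_of_le (Nat.lt_succ_iff.1 hq)
  · obtain ⟨rfl, rfl⟩ := h.nilCol_inj p q a b hs ht
      (h.A_inj ((h.nilCol_mem p).1 _ hs) ((h.nilCol_mem q).1 _ ht) hst)
    obtain rfl := Nat.add_left_cancel (h.eq_of_mem_K hs ht)
    rfl
  · exact absurd hst (h.rowL_ne_A_nilCol p q a b hs ht)
  · exact absurd hst.symm (h.rowL_ne_A_nilCol q p b a ht hs)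
  · obtain ⟨rfl, rfl⟩ := h.rowL_inj p q a b hs ht hst
    obtain rfl := Nat.add_left_cancel (h.eq_of_mem_Z hs ht)
    rfl

theorem range_chainCol (h : IsChainSystem E A C K D Z) :
    Set.range (chainCol E A C K Z) = ⋃ k, C k ∪ K k := by
  apply subset_antisymm
  · rintro _ ⟨⟨⟨k, s, hs⟩, p, hp⟩ | ⟨⟨k, s, hs⟩, p, hp⟩, rfl⟩
    · obtain ⟨a, rfl⟩ := Nat.exists_eq_add_of_le (Nat.lt_succ_iff.1 hp)
      exact Set.mem_iUnion.2 ⟨a, (h.nilCol_mem p).1 a hs⟩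
    · obtain ⟨a, rfl⟩ := Nat.exists_eq_add_of_le (Nat.succ_le_iff.2 hp)
      exact Set.mem_iUnion.2 ⟨a, Or.inl ((h.rowL_mem p).2 a hs).1⟩
  · intro x hx
    obtain ⟨k, hx⟩ := Set.mem_iUnion.1 hx
    rcases h.exists_col hx with ⟨p, s, hs, rfl⟩ | ⟨p, z, hz, rfl⟩
    · exact ⟨Sum.inl ⟨⟨p + k, s, hs⟩, p, Nat.lt_succ_of_le (Nat.le_add_right _ _)⟩, rfl⟩
    · exact ⟨Sum.inr ⟨⟨p + 1 + k, z, hz⟩, p, Nat.le_add_right _ _⟩, rfl⟩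

theorem range_chainRow (h : IsChainSystem E A C K D Z) :
    Set.range (chainRow E A C K Z) = ⋃ k, D k ∪ Z k := by
  apply subset_antisymm
  · rintro _ ⟨⟨⟨k, s, hs⟩, p, hp⟩ | ⟨⟨k, s, hs⟩, p, hp⟩, rfl⟩ <;>
      obtain ⟨a, rfl⟩ := Nat.exists_eq_add_of_le (Nat.lt_succ_iff.1 hp)
    · exact Set.mem_iUnion.2 ⟨a, Or.inl (h.A_mem ((h.nilCol_mem p).1 a hs))⟩
    · exact Set.mem_iUnion.2 ⟨a, (h.rowL_mem p).1 a hs⟩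
  · intro x hx
    obtain ⟨k, hx⟩ := Set.mem_iUnion.1 hx
    rcases h.exists_row hx with ⟨p, s, hs, rfl⟩ | ⟨p, z, hz, rfl⟩
    · exact ⟨Sum.inl ⟨⟨p + k, s, hs⟩, p, Nat.lt_succ_of_le (Nat.le_add_right _ _)⟩, rfl⟩
    · exact ⟨Sum.inr ⟨⟨p + k, z, hz⟩, p, Nat.lt_succ_of_le (Nat.le_add_right _ _)⟩, rfl⟩

end IsChainSystem

end Chains

/-! ### Lists of block sizes -/

/-- Kronecker blocks are given by lists, chains by their starting vectors; an arbitrary enumeration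
of the starts passes from one to the other and keeps multiplicities. -/
theorem exists_list_equiv {α I : Type*} [DecidableEq α] [Finite I] (ℓ : I → α) :
    ∃ (l : List α) (e : Fin l.length ≃ I), (∀ j, l.get j = ℓ (e j)) ∧
      ∀ a, l.count a = Nat.card {i // ℓ i = a} := by
  classical
  have := Fintype.ofFinite I
  let u : List I := Finset.univ.toList
  let e : Fin u.length ≃ I :=
    List.Nodup.getEquivOfForallMemList u (Finset.nodup_toList _) (fun x => by simp [u])
  refine ⟨u.map ℓ, (finCongr (List.length_map ℓ)).trans e, fun j => ?_, fun a => ?_⟩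
  · simp [e]
  · rw [← Multiset.coe_count, ← Multiset.map_coe, Finset.coe_toList, Multiset.count_map,
      Nat.card_eq_fintype_card, Fintype.card_subtype]
    simp only [eq_comm]
    rfl

/-! ### Bases adapted to a subspace -/

section Bases

variable {𝕜 : Type*} [Field 𝕜] {M V : Type*} [AddCommGroup M] [Module 𝕜 M]
  [AddCommGroup V] [Module 𝕜 V] {ι κ : Type*}

theorem repr_coe_inl {S : Submodule 𝕜 M} {B : Basis (ι ⊕ κ) 𝕜 M} {b : Basis ι 𝕜 S}
    (h : ∀ i, B (Sum.inl i) = b i) (x : S) (i : ι) : B.repr x (Sum.inl i) = b.repr x i := by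
  classical
  have h1 : (Finsupp.lapply (Sum.inl i)).comp (B.repr.toLinearMap.comp S.subtype) =
      (Finsupp.lapply i).comp b.repr.toLinearMap := by
    refine b.ext fun j => ?_
    simp [← h, Finsupp.single_apply]
  exact LinearMap.congr_fun h1 x

theorem repr_coe_inr {S : Submodule 𝕜 M} {B : Basis (ι ⊕ κ) 𝕜 M} {b : Basis ι 𝕜 S}
    (h : ∀ i, B (Sum.inl i) = b i) (x : S) (i : κ) : B.repr x (Sum.inr i) = 0 := by
  classical
  have h1 : (Finsupp.lapply (Sum.inr i)).comp (B.repr.toLinearMap.comp S.subtype) = 0 := by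
    refine b.ext fun j => ?_
    simp [← h]
  exact LinearMap.congr_fun h1 x

theorem span_range_coe_basis {S : Submodule 𝕜 M} (b : Basis ι 𝕜 S) :
    Submodule.span 𝕜 (Set.range fun i => (b i : M)) = S := by
  have : (Set.range fun i => (b i : M)) = S.subtype '' Set.range b := by
    rw [← Set.range_comp]
    rfl
  rw [this, ← Submodule.map_span, b.span_eq, Submodule.map_subtype_top]

theorem exists_basis_sum {S T : Submodule 𝕜 M} (hS : IsDirectSum ⊤ S T) (b : Basis ι 𝕜 S)
    {s : Set M} (hs : IsBasisOf s T) {v : κ → M} (hv : Function.Injective v)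
    (hvs : Set.range v = s) :
    ∃ B : Basis (ι ⊕ κ) 𝕜 M, (∀ i, B (Sum.inl i) = b i) ∧ ∀ j, B (Sum.inr j) = v j := by
  have hli : LinearIndependent 𝕜 v := by
    have := hs.1
    rw [← hvs] at this
    exact (linearIndepOn_id_range_iff hv).1 this
  have hb : LinearIndependent 𝕜 fun i => (b i : M) :=
    b.linearIndependent.map' S.subtype S.ker_subtype
  have hspan := span_range_coe_basis b
  have hspan' : Submodule.span 𝕜 (Set.range v) = T := by rw [hvs, hs.2]
  refine ⟨Basis.mk (hb.sum_type hli (by rw [hspan, hspan']; exact hS.1)) ?_, ?_, ?_⟩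
  · rw [Set.Sum.elim_range, Submodule.span_union, hspan, hspan', hS.2]
  · simp
  · simp

theorem finrank_map_of_disjoint_ker {f : M →ₗ[𝕜] V} {S : Submodule 𝕜 M}
    (h : Disjoint (LinearMap.ker f) S) : finrank 𝕜 (S.map f) = finrank 𝕜 S := by
  rw [← LinearMap.range_domRestrict]
  refine LinearMap.finrank_range_of_inj fun x y hxy => Subtype.ext ?_
  exact LinearMap.disjoint_ker_iff_injOn.1 h.symm x.2 y.2 hxy

theorem IsBasisOf.card_eq {b : Set M} {S : Submodule 𝕜 M} (h : IsBasisOf b S) :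
    Nat.card b = finrank 𝕜 S := by
  have := (Basis.span (v := ((↑) : b → M)) h.1)
  rw [Subtype.range_coe, h.2] at this
  exact (finrank_eq_nat_card_basis this).symm

/-- The direct sums `S k = S (k+1) ⊕ T k` telescope, so the bases of the first `n` layers together
span a complement of `S n`. -/
theorem isBasisOf_iUnion_of_flag {S : ℕ → Submodule 𝕜 M} {b : ℕ → Set M}
    {T : ℕ → Submodule 𝕜 M} (h0 : S 0 = ⊤) (hS : ∀ k, IsDirectSum (S k) (S (k + 1)) (T k))
    (hb : ∀ k, IsBasisOf (b k) (T k)) (n : ℕ) :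
    ∃ U, IsDirectSum ⊤ (S n) U ∧ IsBasisOf (⋃ k < n, b k) U := by
  induction n with
  | zero =>
    exact ⟨⊥, ⟨disjoint_bot_right, by simp [h0]⟩, by simp [IsBasisOf, linearIndepOn_empty]⟩
  | succ n ih =>
    obtain ⟨U, hU, hbU⟩ := ih
    have hTS : T n ≤ S n := le_sup_right.trans (hS n).2.le
    refine ⟨T n ⊔ U, ⟨?_, ?_⟩, ?_⟩
    · refine Disjoint.disjoint_sup_right_of_disjoint_sup_left (hS n).1 ?_
      rw [(hS n).2]
      exact hU.1
    · rw [← sup_assoc, (hS n).2, hU.2]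
    · have : (⋃ k < n + 1, b k) = b n ∪ ⋃ k < n, b k := by
        rw [Set.biUnion_lt_succ, Set.union_comm]
      rw [this]
      exact (hb n).union hbU (hU.1.mono_left hTS)

/-- For `k < l` the layer `T l` lies in `S (k+1)`, which meets `T k` only in `0`, and basis vectors
are nonzero. -/
theorem disjoint_of_flag {S : ℕ → Submodule 𝕜 M} {b : ℕ → Set M}
    {T : ℕ → Submodule 𝕜 M} (hS : ∀ k, IsDirectSum (S k) (S (k + 1)) (T k))
    (hb : ∀ k, IsBasisOf (b k) (T k)) (k l : ℕ) (hkl : k ≠ l) : Disjoint (b k) (b l) := by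
  wlog h : k < l generalizing k l
  · exact (this l k hkl.symm (by omega)).symm
  have hanti : Antitone S := antitone_nat_of_succ_le fun k => le_sup_left.trans (hS k).2.le
  rw [Set.disjoint_left]
  intro x hk hl
  have h1 : x ∈ T k := (hb k).2 ▸ Submodule.subset_span hk
  have h2 : x ∈ T l := (hb l).2 ▸ Submodule.subset_span hl
  have h3 : x ∈ S (k + 1) := hanti (Nat.succ_le_iff.2 h) (le_sup_right.trans (hS l).2.le h2)
  have h4 : x = 0 := Submodule.disjoint_def.1 (hS k).1 x h3 h1
  exact (hb k).1.ne_zero hk h4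

theorem IsBasisOf.disjoint {b b' : Set M} {S S' : Submodule 𝕜 M} (h : IsBasisOf b S)
    (h' : IsBasisOf b' S') (hd : Disjoint S S') : Disjoint b b' := by
  rw [Set.disjoint_left]
  intro x hx hx'
  refine h.1.ne_zero hx (Submodule.disjoint_def.1 hd x ?_ ?_)
  · exact h.2 ▸ Submodule.subset_span hx
  · exact h'.2 ▸ Submodule.subset_span hx'

theorem IsBasisOf.eq_empty {b : Set M} (h : IsBasisOf b (⊥ : Submodule 𝕜 M)) : b = ∅ := by
  rw [Set.eq_empty_iff_forall_notMem]
  intro x hx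
  have h1 : x ∈ (⊥ : Submodule 𝕜 M) := h.2 ▸ Submodule.subset_span hx
  exact h.1.ne_zero hx h1

end Bases

/-! ### The chains of a reduction decomposition -/

namespace ReductionDecomposition

variable {𝕜 : Type*} [Field 𝕜] {M V : Type*} [AddCommGroup M] [Module 𝕜 M]
  [AddCommGroup V] [Module 𝕜 V] {E A : M →ₗ[𝕜] V} (d : ReductionDecomposition E A)

theorem isBasis_N (k : ℕ) : IsBasisOf (d.basisC (k + 1) ∪ d.basisK (k + 1)) (d.N (k + 1)) :=
  (d.N_eq (k + 1) (by omega)).isBasisOf_union (d.isBasis_C _ (by omega))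
    (d.isBasis_K _ (by omega))

theorem isBasis_W (k : ℕ) : IsBasisOf (d.basisD (k + 1) ∪ d.basisZ (k + 1)) (d.W (k + 1)) :=
  (d.W_eq (k + 1) (by omega)).isBasisOf_union (d.isBasis_D _ (by omega))
    (d.isBasis_Z _ (by omega))

theorem C_le_N (k : ℕ) : d.C (k + 1) ≤ d.N (k + 1) :=
  le_sup_left.trans (d.N_eq (k + 1) (by omega)).2.le

theorem K_le_ker (k : ℕ) : d.K (k + 1) ≤ LinearMap.ker E := by
  rw [← d.ker_E (k + 1) (by omega)]
  exact inf_le_left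

theorem disjoint_ker_C (k : ℕ) : Disjoint (LinearMap.ker E) (d.C (k + 1)) := by
  rw [disjoint_iff_inf_le]
  refine (le_inf ?_ inf_le_right).trans (d.N_eq (k + 1) (by omega)).1.symm.le_bot
  rw [← d.ker_E (k + 1) (by omega)]
  exact inf_le_inf_left _ (d.C_le_N k)

theorem map_E_C (k : ℕ) : (d.C (k + 1)).map E = d.W (k + 2) := by
  rw [← d.map_E (k + 1) (by omega), ← (d.N_eq (k + 1) (by omega)).2, Submodule.map_sup,
    LinearMap.le_ker_iff_map.1 (d.K_le_ker k), sup_bot_eq]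

theorem basisM_eq : d.basisM = ⋃ k, d.basisC (k + 1) ∪ d.basisK (k + 1) := by
  ext x
  simp only [basisM, Set.mem_iUnion]
  constructor
  · rintro ⟨k, hk, hx⟩
    obtain ⟨k, rfl⟩ := Nat.exists_eq_add_of_le' hk
    exact ⟨k, hx⟩
  · rintro ⟨k, hx⟩
    exact ⟨k + 1, by omega, hx⟩

theorem basisV_eq : d.basisV = ⋃ k, d.basisD (k + 1) ∪ d.basisZ (k + 1) := by
  ext x
  simp only [basisV, Set.mem_iUnion]
  constructor
  · rintro ⟨k, hk, hx⟩
    obtain ⟨k, rfl⟩ := Nat.exists_eq_add_of_le' hk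
    exact ⟨k, hx⟩
  · rintro ⟨k, hx⟩
    exact ⟨k + 1, by omega, hx⟩

variable [FiniteDimensional 𝕜 M] [FiniteDimensional 𝕜 V]

/-- `E` maps `C^(k)` isomorphically onto `W^(k+1)`, so `dim K^(k) = dim N^(k) - dim W^(k+1)`, the
same alternating sum of dimensions as for the defect. -/
theorem finrank_K (k : ℕ) : finrank 𝕜 (d.K (k + 1)) = alpha E A (k + 1) := by
  have h1 := alpha_succ_add E A k
  have h2 := (d.dom_eq k).finrank_add
  have h3 : finrank 𝕜 (iter E A (k + 2)).cod + finrank 𝕜 (d.W (k + 2)) = _ :=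
    (d.cod_eq (k + 1)).finrank_add
  have h4 := (d.N_eq (k + 1) (by omega)).finrank_add
  have h5 := finrank_map_of_disjoint_ker (d.disjoint_ker_C k)
  rw [d.map_E_C] at h5
  omega

/-- Likewise `A` maps `N^(k)` isomorphically onto `D^(k)`, so `dim Z^(k) = dim W^(k) - dim N^(k)`.
-/
theorem finrank_Z (k : ℕ) : finrank 𝕜 (d.Z (k + 1)) = betaPlus E A (k + 1) := by
  have h1 := betaPlus_succ_add E A k
  have h2 := (d.dom_eq k).finrank_add
  have h3 := (d.cod_eq k).finrank_add
  have h4 := (d.W_eq (k + 1) (by omega)).finrank_add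
  have h5 := finrank_map_of_disjoint_ker (d.ker_A (k + 1) (by omega))
  rw [d.map_A _ (by omega)] at h5
  omega

theorem N_eq_bot {k : ℕ} (hk : index E A ≤ k) : d.N (k + 1) = ⊥ := by
  have h := (d.dom_eq k)
  rw [iter_eq_totallyReduced hk, iter_eq_totallyReduced (hk.trans k.le_succ)] at h
  rw [← disjoint_self]
  exact h.1.mono_left (le_sup_right.trans h.2.le)

theorem W_eq_bot {k : ℕ} (hk : index E A ≤ k) : d.W (k + 1) = ⊥ := by
  have h := (d.cod_eq k)
  rw [iter_eq_totallyReduced hk, iter_eq_totallyReduced (hk.trans k.le_succ)] at h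
  rw [← disjoint_self]
  exact h.1.mono_left (le_sup_right.trans h.2.le)

theorem iUnion_lt_index_basisM :
    (⋃ k < index E A, d.basisC (k + 1) ∪ d.basisK (k + 1)) = d.basisM := by
  rw [basisM_eq]
  refine subset_antisymm (Set.iUnion₂_subset fun k _ => Set.subset_iUnion_of_subset k le_rfl)
    (Set.iUnion_subset fun k => ?_)
  by_cases hk : k < index E A
  · exact Set.subset_iUnion₂_of_subset k hk le_rfl
  · have h := d.isBasis_N k
    rw [d.N_eq_bot (by omega)] at h
    rw [h.eq_empty]
    exact Set.empty_subset _

theorem iUnion_lt_index_basisV :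
    (⋃ k < index E A, d.basisD (k + 1) ∪ d.basisZ (k + 1)) = d.basisV := by
  rw [basisV_eq]
  refine subset_antisymm (Set.iUnion₂_subset fun k _ => Set.subset_iUnion_of_subset k le_rfl)
    (Set.iUnion_subset fun k => ?_)
  by_cases hk : k < index E A
  · exact Set.subset_iUnion₂_of_subset k hk le_rfl
  · have h := d.isBasis_W k
    rw [d.W_eq_bot (by omega)] at h
    rw [h.eq_empty]
    exact Set.empty_subset _

theorem exists_isBasisOf_basisM :
    ∃ T, IsDirectSum ⊤ (domInf E A) T ∧ IsBasisOf d.basisM T := by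
  rw [← d.iUnion_lt_index_basisM]
  exact isBasisOf_iUnion_of_flag rfl d.dom_eq d.isBasis_N (index E A)

theorem exists_isBasisOf_basisV :
    ∃ T, IsDirectSum ⊤ (codInf E A) T ∧ IsBasisOf d.basisV T := by
  rw [← d.iUnion_lt_index_basisV]
  exact isBasisOf_iUnion_of_flag rfl d.cod_eq d.isBasis_W (index E A)

/-- Injectivity across levels holds because the images lie in bases of different layers `W`; within
a level it holds because `ker A` misses `N` and `ker E` misses `C`. -/
theorem isChainSystem : IsChainSystem E A (fun k => d.basisC (k + 1)) (fun k => d.basisK (k + 1))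
    (fun k => d.basisD (k + 1)) (fun k => d.basisZ (k + 1)) where
  image_A k := d.image_A _ (by omega)
  image_E k := d.image_E _ (by omega)
  disjoint_N := disjoint_of_flag d.dom_eq d.isBasis_N
  disjoint_CK k := (d.isBasis_C _ (by omega)).disjoint (d.isBasis_K _ (by omega))
    (d.N_eq _ (by omega)).1
  disjoint_W := disjoint_of_flag d.cod_eq d.isBasis_W
  disjoint_DZ k := (d.isBasis_D _ (by omega)).disjoint (d.isBasis_Z _ (by omega))
    (d.W_eq _ (by omega)).1
  eventually_empty := by
    refine ⟨index E A, fun k hk => ?_⟩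
    have h := d.isBasis_N k
    rw [d.N_eq_bot hk] at h
    exact h.eq_empty
  injOn_A := by
    intro x hx y hy hxy
    obtain ⟨k, hx⟩ := Set.mem_iUnion.1 hx
    obtain ⟨l, hy⟩ := Set.mem_iUnion.1 hy
    have h1 : A x ∈ d.basisD (k + 1) := d.image_A (k + 1) (by omega) ▸ Set.mem_image_of_mem A hx
    have h2 : A y ∈ d.basisD (l + 1) := d.image_A (l + 1) (by omega) ▸ Set.mem_image_of_mem A hy
    have hkl : k = l := by
      by_contra hkl
      exact Set.disjoint_left.1 (disjoint_of_flag d.cod_eq d.isBasis_W k l hkl) (Or.inl h1)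
        (Or.inl (hxy ▸ h2))
    subst hkl
    have h3 := (d.isBasis_N k).2
    exact LinearMap.disjoint_ker_iff_injOn.1 (d.ker_A (k + 1) (by omega)).symm
      (h3 ▸ Submodule.subset_span hx) (h3 ▸ Submodule.subset_span hy) hxy
  injOn_E := by
    intro x hx y hy hxy
    obtain ⟨k, hx⟩ := Set.mem_iUnion.1 hx
    obtain ⟨l, hy⟩ := Set.mem_iUnion.1 hy
    have h1 : E x ∈ d.basisD (k + 2) ∪ d.basisZ (k + 2) :=
      d.image_E (k + 1) (by omega) ▸ Set.mem_image_of_mem E hx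
    have h2 : E y ∈ d.basisD (l + 2) ∪ d.basisZ (l + 2) :=
      d.image_E (l + 1) (by omega) ▸ Set.mem_image_of_mem E hy
    have hkl : k = l := by
      by_contra hkl
      exact Set.disjoint_left.1 (disjoint_of_flag d.cod_eq d.isBasis_W (k + 1) (l + 1)
        (by omega)) h1 (hxy ▸ h2)
    subst hkl
    have h3 := (d.isBasis_C (k + 1) (by omega)).2
    exact LinearMap.disjoint_ker_iff_injOn.1 (d.disjoint_ker_C k).symm
      (h3 ▸ Submodule.subset_span hx) (h3 ▸ Submodule.subset_span hy) hxy

theorem finite_basisK : Finite (Σ k, d.basisK (k + 1)) := by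
  obtain ⟨T, -, hT⟩ := d.exists_isBasisOf_basisM
  have : Finite d.basisM := hT.1.finite
  refine Finite.of_injective (β := d.basisM)
    (fun i => ⟨i.2, by rw [basisM_eq]; exact Set.mem_iUnion.2 ⟨i.1, Or.inr i.2.2⟩⟩) ?_
  rintro ⟨k, x, hx⟩ ⟨l, y, hy⟩ h
  obtain rfl : x = y := congrArg Subtype.val h
  obtain rfl := d.isChainSystem.eq_of_mem_K hx hy
  rfl

theorem finite_basisZ : Finite (Σ k, d.basisZ (k + 1)) := by
  obtain ⟨T, -, hT⟩ := d.exists_isBasisOf_basisV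
  have : Finite d.basisV := hT.1.finite
  refine Finite.of_injective (β := d.basisV)
    (fun i => ⟨i.2, by rw [basisV_eq]; exact Set.mem_iUnion.2 ⟨i.1, Or.inr i.2.2⟩⟩) ?_
  rintro ⟨k, x, hx⟩ ⟨l, y, hy⟩ h
  obtain rfl : x = y := congrArg Subtype.val h
  obtain rfl := d.isChainSystem.eq_of_mem_Z hx hy
  rfl

end ReductionDecomposition

/-! ### The matrices of a system in the basis made of the chains -/

section Chains

variable {𝕜 : Type*} [Field 𝕜]

theorem blockDiagonal'_apply_eq {m : Type*} [DecidableEq m] {r c : m → ℕ}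
    (B : ∀ i, Matrix (Fin (r i)) (Fin (c i)) 𝕜) (f : ℕ → ℕ → 𝕜)
    (hf : ∀ i p q, B i p q = f p q) (x : Σ i, Fin (r i)) (y : Σ i, Fin (c i)) :
    Matrix.blockDiagonal' B x y = if x.1 = y.1 then f x.2 y.2 else 0 := by
  obtain ⟨i, p⟩ := x
  obtain ⟨j, q⟩ := y
  by_cases h : i = j
  · subst h
    simp [Matrix.blockDiagonal'_apply_eq, hf]
  · rw [Matrix.blockDiagonal'_apply_ne _ _ _ h]
    simp [h]

theorem blockDiagonal'_blockNE {m : Type*} [DecidableEq m] (r : m → ℕ)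
    (x y : Σ i, Fin (r i)) :
    Matrix.blockDiagonal' (fun i => blockNE 𝕜 (r i)) x y =
      if x.1 = y.1 then if (x.2 : ℕ) + 1 = y.2 then 1 else 0 else 0 :=
  blockDiagonal'_apply_eq _ (fun p q => if p + 1 = q then 1 else 0) (fun _ _ _ => rfl) x y

theorem blockDiagonal'_blockNA {m : Type*} [DecidableEq m] (r : m → ℕ)
    (x y : Σ i, Fin (r i)) :
    Matrix.blockDiagonal' (fun i => blockNA 𝕜 (r i)) x y =
      if x.1 = y.1 then if (x.2 : ℕ) = y.2 then 1 else 0 else 0 :=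
  blockDiagonal'_apply_eq _ (fun p q => if p = q then 1 else 0)
    (fun i p q => by simp [blockNA, Matrix.one_apply, Fin.ext_iff]) x y

theorem blockDiagonal'_blockLE {m : Type*} [DecidableEq m] (r : m → ℕ)
    (x : Σ i, Fin (r i)) (y : Σ i, Fin (r i - 1)) :
    Matrix.blockDiagonal' (fun i => blockLE 𝕜 (r i)) x y =
      if x.1 = y.1 then if (x.2 : ℕ) = y.2 then 1 else 0 else 0 :=
  blockDiagonal'_apply_eq _ (fun p q => if p = q then 1 else 0) (fun _ _ _ => rfl) x y

theorem blockDiagonal'_blockLA {m : Type*} [DecidableEq m] (r : m → ℕ)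
    (x : Σ i, Fin (r i)) (y : Σ i, Fin (r i - 1)) :
    Matrix.blockDiagonal' (fun i => blockLA 𝕜 (r i)) x y =
      if x.1 = y.1 then if (x.2 : ℕ) = y.2 + 1 then 1 else 0 else 0 :=
  blockDiagonal'_apply_eq _ (fun p q => if p = q + 1 then 1 else 0) (fun _ _ _ => rfl) x y

theorem sigma_fin_ext_iff {m : Type*} {r : m → ℕ} {x y : Σ i, Fin (r i)} :
    x = y ↔ x.1 = y.1 ∧ (x.2 : ℕ) = y.2 := by
  constructor
  · rintro rfl
    exact ⟨rfl, rfl⟩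
  · obtain ⟨i, p⟩ := x
    obtain ⟨j, q⟩ := y
    rintro ⟨h, h'⟩
    obtain rfl : i = j := h
    exact congrArg _ (Fin.ext h')

theorem card_sigma_fiber {X : Type*} (S : ℕ → Set X) (k : ℕ) :
    Nat.card {i : Σ k, S (k + 1) // i.1 + 1 = k + 1} = Nat.card (S (k + 1)) := by
  refine Nat.card_congr ⟨fun i => ⟨i.1.2, ?_⟩, fun s => ⟨⟨k, s⟩, rfl⟩, ?_, fun s => rfl⟩
  · exact (congrArg (fun l => (i.1.2 : X) ∈ S l) i.2).mp i.1.2.2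
  · rintro ⟨⟨l, s⟩, hl⟩
    obtain rfl : l = k := by simpa using hl
    rfl

end Chains

namespace ReductionDecomposition

variable {𝕜 : Type*} [Field 𝕜] {M V : Type*} [AddCommGroup M] [Module 𝕜 M]
  [AddCommGroup V] [Module 𝕜 V] {E A : M →ₗ[𝕜] V}
  [FiniteDimensional 𝕜 M] [FiniteDimensional 𝕜 V]

/-- The basis vectors of a reduction decomposition are those of chains, one for each basis vector
of the spaces `K^(k)` and `Z^(k)`. -/
theorem exists_chains (d : ReductionDecomposition E A) :
    ∃ ν L : List ℕ, (∀ k ∈ ν, 1 ≤ k) ∧ (∀ k ∈ L, 1 ≤ k) ∧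
      (∀ k ≥ 1, ν.count k = alpha E A k ∧ L.count k = betaPlus E A k) ∧
      ∃ (x : Fin ν.length → ℕ → M) (u : Fin L.length → ℕ → M) (w : Fin L.length → ℕ → V),
        (∀ i, E (x i 0) = 0) ∧
        (∀ i p, p + 1 < ν.get i → E (x i (p + 1)) = A (x i p)) ∧
        (∀ i p, p + 1 < L.get i → E (u i p) = w i p ∧ A (u i p) = w i (p + 1)) ∧
        ∃ (f : (Σ i : Fin ν.length, Fin (ν.get i)) ⊕
              (Σ i : Fin L.length, Fin (L.get i - 1)) → M)
          (g : (Σ i : Fin ν.length, Fin (ν.get i)) ⊕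
              (Σ i : Fin L.length, Fin (L.get i)) → V),
          (∀ j, f (Sum.inl j) = x j.1 j.2) ∧ (∀ j, f (Sum.inr j) = u j.1 j.2) ∧
          (∀ j, g (Sum.inl j) = A (x j.1 j.2)) ∧ (∀ j, g (Sum.inr j) = w j.1 j.2) ∧
          Function.Injective f ∧ Set.range f = d.basisM ∧
          Function.Injective g ∧ Set.range g = d.basisV := by
  have h := d.isChainSystem
  have := d.finite_basisK
  have := d.finite_basisZ
  obtain ⟨ν, eN, hN, hcN⟩ := exists_list_equiv fun i : Σ k, d.basisK (k + 1) => i.1 + 1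
  obtain ⟨L, eL, hL, hcL⟩ := exists_list_equiv fun i : Σ k, d.basisZ (k + 1) => i.1 + 1
  let eNil : (Σ i : Fin ν.length, Fin (ν.get i)) ≃
      Σ i : (Σ k, d.basisK (k + 1)), Fin (i.1 + 1) :=
    Equiv.sigmaCongr eN fun i => finCongr (hN i)
  let eRow : (Σ i : Fin L.length, Fin (L.get i)) ≃
      Σ i : (Σ k, d.basisZ (k + 1)), Fin (i.1 + 1) :=
    Equiv.sigmaCongr eL fun i => finCongr (hL i)
  -- A start in `basisZ (k + 1)` gives `k + 1` rows but only `k` columns: the last row, at the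
  -- lowest level, has no lift through `E`.
  let eCol : (Σ i : Fin L.length, Fin (L.get i - 1)) ≃ Σ i : (Σ k, d.basisZ (k + 1)), Fin i.1 :=
    Equiv.sigmaCongr eL fun i => finCongr (by rw [hL]; rfl)
  let C := fun k => d.basisC (k + 1)
  refine ⟨ν, L, fun k hk => ?_, fun k hk => ?_, fun k hk => ?_,
    fun i => nilCol E A C (eN i).2, fun i => colL E A C (eL i).2, fun i => rowL E A C (eL i).2,
    fun i => ?_, fun i p hp => ?_, fun i p hp => ?_,
    chainCol E A C (fun k => d.basisK (k + 1)) (fun k => d.basisZ (k + 1)) ∘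
      Equiv.sumCongr eNil eCol,
    chainRow E A C (fun k => d.basisK (k + 1)) (fun k => d.basisZ (k + 1)) ∘
      Equiv.sumCongr eNil eRow,
    fun _ => rfl, fun _ => rfl, fun _ => rfl, fun _ => rfl,
    h.chainCol_injective.comp (Equiv.injective _), ?_,
    h.chainRow_injective.comp (Equiv.injective _), ?_⟩
  · obtain ⟨i, rfl⟩ := List.get_of_mem hk
    rw [hN]
    omega
  · obtain ⟨i, rfl⟩ := List.get_of_mem hk
    rw [hL]
    omega
  · obtain ⟨k, rfl⟩ := Nat.exists_eq_add_of_le' hk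
    rw [hcN, hcL, card_sigma_fiber d.basisK, card_sigma_fiber d.basisZ,
      (d.isBasis_K _ hk).card_eq, (d.isBasis_Z _ hk).card_eq,
      d.finrank_K, d.finrank_Z]
    exact ⟨rfl, rfl⟩
  · refine LinearMap.mem_ker.1 (d.K_le_ker (eN i).1 ?_)
    rw [← (d.isBasis_K _ (by omega)).2]
    exact Submodule.subset_span (eN i).2.2
  · rw [hN] at hp
    obtain ⟨a, ha⟩ := Nat.exists_eq_add_of_le (Nat.lt_succ_iff.1 hp)
    refine ((h.nilCol_mem p).2 a ?_).2
    exact (congrArg (fun k => ((eN i).2 : M) ∈ d.basisK (k + 1)) ha).mp (eN i).2.2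
  · rw [hL] at hp
    obtain ⟨a, ha⟩ := Nat.exists_eq_add_of_le (Nat.lt_succ_iff.1 hp)
    refine ((h.rowL_mem p).2 a ?_).2
    exact (congrArg (fun k => ((eL i).2 : V) ∈ d.basisZ (k + 1)) ha).mp (eL i).2.2
  · rw [EquivLike.range_comp, h.range_chainCol, basisM_eq]
  · rw [EquivLike.range_comp, h.range_chainRow, basisV_eq]

/-- The chains span complements of `M^(∞)` and `V^(∞)`, and both maps respect this splitting. The
bases of the stationary spaces are left free because they are later obtained from a decomposition of
the dual. -/
theorem exists_bases (d : ReductionDecomposition E A) {ι κ : Type*} [Fintype ι] [Fintype κ]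
    [DecidableEq ι] [DecidableEq κ] (bM : Basis ι 𝕜 (domInf E A)) (bV : Basis κ 𝕜 (codInf E A)) :
    ∃ ν L : List ℕ, (∀ k ∈ ν, 1 ≤ k) ∧ (∀ k ∈ L, 1 ≤ k) ∧
      (∀ k ≥ 1, ν.count k = alpha E A k ∧ L.count k = betaPlus E A k) ∧
      ∃ (BM : Basis (ι ⊕ ((Σ i : Fin ν.length, Fin (ν.get i)) ⊕
            (Σ i : Fin L.length, Fin (L.get i - 1)))) 𝕜 M)
        (BV : Basis (κ ⊕ ((Σ i : Fin ν.length, Fin (ν.get i)) ⊕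
            (Σ i : Fin L.length, Fin (L.get i)))) 𝕜 V),
        (∀ i, BM (Sum.inl i) = bM i) ∧ Set.range (fun i => BM (Sum.inr i)) = d.basisM ∧
        (∀ i, BV (Sum.inl i) = bV i) ∧ Set.range (fun i => BV (Sum.inr i)) = d.basisV ∧
        LinearMap.toMatrix BM BV E =
          Matrix.fromBlocks (LinearMap.toMatrix bM bV (EInf E A)) 0 0
            (Matrix.fromBlocks (Matrix.blockDiagonal' fun i => blockNE 𝕜 (ν.get i)) 0 0
              (Matrix.blockDiagonal' fun i => blockLE 𝕜 (L.get i))) ∧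
        LinearMap.toMatrix BM BV A =
          Matrix.fromBlocks (LinearMap.toMatrix bM bV (AInf E A)) 0 0
            (Matrix.fromBlocks (Matrix.blockDiagonal' fun i => blockNA 𝕜 (ν.get i)) 0 0
              (Matrix.blockDiagonal' fun i => blockLA 𝕜 (L.get i))) := by
  obtain ⟨ν, L, hnil, hL, hcount, x, u, w, hx0, hx, hu, f, g, hfx, hfu, hgx, hgw, hf, hfr, hg,
    hgr⟩ := d.exists_chains
  obtain ⟨T, hT, hbT⟩ := d.exists_isBasisOf_basisM
  obtain ⟨U, hU, hbU⟩ := d.exists_isBasisOf_basisV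
  obtain ⟨BM, hBM, hBMf⟩ := exists_basis_sum hT bM hbT hf hfr
  obtain ⟨BV, hBV, hBVg⟩ := exists_basis_sum hU bV hbU hg hgr
  refine ⟨ν, L, hnil, hL, hcount, BM, BV, hBM, by simp only [hBMf]; exact hfr, hBV,
    by simp only [hBVg]; exact hgr, ?_, ?_⟩
  · ext i j
    rw [LinearMap.toMatrix_apply]
    -- The first column of each nilpotent chain is a case of its own, since `E` kills it.
    rcases j with j | ⟨j, ⟨_ | p, hp⟩⟩ | ⟨j, ⟨p, hp⟩⟩
    · have h1 : E (BM (Sum.inl j)) = (EInf E A (bM j) : V) := by rw [hBM]; rfl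
      rw [h1]
      rcases i with i | i
      · rw [repr_coe_inl hBV, Matrix.fromBlocks_apply₁₁, LinearMap.toMatrix_apply]
      · rw [repr_coe_inr hBV]
        rfl
    · rw [hBMf, hfx, hx0]
      rcases i with i | i | i <;> simp [blockDiagonal'_blockNE]
    · have h1 : E (BM (Sum.inr (Sum.inl ⟨j, p + 1, hp⟩))) =
          BV (Sum.inr (Sum.inl ⟨j, p, by omega⟩)) := by
        rw [hBMf, hfx, hBVg, hgx]
        exact hx j p hp
      rw [h1, Basis.repr_self, Finsupp.single_apply]
      rcases i with i | i | i <;>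
        simp [blockDiagonal'_blockNE, sigma_fin_ext_iff, ite_and, eq_comm]
    · have h1 : E (BM (Sum.inr (Sum.inr ⟨j, p, hp⟩))) =
          BV (Sum.inr (Sum.inr ⟨j, p, by omega⟩)) := by
        rw [hBMf, hfu, hBVg, hgw]
        exact (hu j p (by omega)).1
      rw [h1, Basis.repr_self, Finsupp.single_apply]
      rcases i with i | i | i <;>
        simp [blockDiagonal'_blockLE, sigma_fin_ext_iff, ite_and, eq_comm]
  · ext i j
    rw [LinearMap.toMatrix_apply]
    rcases j with j | ⟨j, ⟨p, hp⟩⟩ | ⟨j, ⟨p, hp⟩⟩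
    · have h1 : A (BM (Sum.inl j)) = (AInf E A (bM j) : V) := by rw [hBM]; rfl
      rw [h1]
      rcases i with i | i
      · rw [repr_coe_inl hBV, Matrix.fromBlocks_apply₁₁, LinearMap.toMatrix_apply]
      · rw [repr_coe_inr hBV]
        rfl
    · have h1 : A (BM (Sum.inr (Sum.inl ⟨j, p, hp⟩))) =
          BV (Sum.inr (Sum.inl ⟨j, p, hp⟩)) := by
        rw [hBMf, hfx, hBVg, hgx]
      rw [h1, Basis.repr_self, Finsupp.single_apply]
      rcases i with i | i | i <;>
        simp [blockDiagonal'_blockNA, sigma_fin_ext_iff, ite_and, eq_comm]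
    · have h1 : A (BM (Sum.inr (Sum.inr ⟨j, p, hp⟩))) =
          BV (Sum.inr (Sum.inr ⟨j, p + 1, by omega⟩)) := by
        rw [hBMf, hfu, hBVg, hgw]
        exact (hu j p (by omega)).2
      rw [h1, Basis.repr_self, Finsupp.single_apply]
      rcases i with i | i | i <;>
        simp [blockDiagonal'_blockLA, sigma_fin_ext_iff, ite_and, eq_comm]

end ReductionDecomposition

/-! ### Jordan bases -/

section Jordan

variable {𝕜 : Type*} [Field 𝕜] {U : Type*} [AddCommGroup U] [Module 𝕜 U]

theorem blockDiagonal'_jordanBlock {m : Type*} [DecidableEq m] (c : m → 𝕜) (r : m → ℕ)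
    (x y : Σ i, Fin (r i)) :
    Matrix.blockDiagonal' (fun i => jordanBlock (c i) (r i)) x y =
      if x.1 = y.1 then (if (x.2 : ℕ) = y.2 then c y.1 else 0) +
        if (x.2 : ℕ) + 1 = y.2 then 1 else 0 else 0 := by
  obtain ⟨i, p⟩ := x
  obtain ⟨j, q⟩ := y
  by_cases h : i = j
  · subst h
    simp [Matrix.blockDiagonal'_apply_eq, jordanBlock, blockNE, Matrix.one_apply, Fin.ext_iff]
  · rw [Matrix.blockDiagonal'_apply_ne _ _ _ h]
    simp [h]

/-- When `A` is the identity, a vector of the reduced domain is itself an image under `g` of the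
previous domain. -/
theorem iter_id_le_range_pow (g : End 𝕜 U) (k : ℕ) :
    (iter g LinearMap.id k).dom ≤ LinearMap.range (g ^ k) := by
  induction k with
  | zero => simp [End.one_eq_id]
  | succ k ih =>
    intro x hx
    have h : x ∈ (iter g LinearMap.id (k + 1)).cod := (mem_iter_succ_dom.1 hx).2
    rw [iter_succ_cod] at h
    obtain ⟨y, hy, rfl⟩ := h
    obtain ⟨z, rfl⟩ := ih hy
    exact ⟨z, by rw [pow_succ', End.mul_apply]⟩

variable [FiniteDimensional 𝕜 U]

theorem domInf_id_eq_bot {g : End 𝕜 U} (hg : IsNilpotent g) :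
    domInf g LinearMap.id = ⊥ := by
  obtain ⟨n, hn⟩ := hg
  have h := iter_id_le_range_pow g n
  rw [hn, LinearMap.range_zero] at h
  exact le_bot_iff.1 ((domInf_le_iter n).trans h)

/-- Apply the chain construction to `(g, id)`. Nilpotency leaves no stationary part, and the
nilpotent chains satisfy `g x_{p+1} = x_p`, `g x_0 = 0`, which is a Jordan basis once `L` blocks are
excluded. -/
theorem exists_nilpotent_basis {g : End 𝕜 U} (hg : IsNilpotent g) :
    ∃ l : List ℕ, (∀ k ∈ l, 1 ≤ k) ∧
      ∃ b : Basis (Σ i : Fin l.length, Fin (l.get i)) 𝕜 U, ∀ i,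
        (∀ h : 0 < l.get i, g (b ⟨i, 0, h⟩) = 0) ∧
        ∀ p, ∀ h : p + 1 < l.get i, g (b ⟨i, p + 1, h⟩) = b ⟨i, p, by omega⟩ := by
  obtain ⟨d⟩ := nonempty_reductionDecomposition g LinearMap.id
  obtain ⟨l, L, hl, hL, -, x, u, w, hx0, hx, -, f, f', hfx, -, hfx', -, hf, hfr, hf', hfr'⟩ :=
    d.exists_chains
  obtain ⟨T, hT, hbT⟩ := d.exists_isBasisOf_basisM
  obtain ⟨T', hT', hbT'⟩ := d.exists_isBasisOf_basisV
  have hM := domInf_id_eq_bot hg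
  have hV : codInf g LinearMap.id = ⊥ := by rw [← map_E_domInf, hM, Submodule.map_bot]
  have : Subsingleton (domInf g LinearMap.id) := by rw [hM]; infer_instance
  have : Subsingleton (codInf g LinearMap.id) := by rw [hV]; infer_instance
  obtain ⟨B, -, hB⟩ := exists_basis_sum hT (Basis.empty _ : Basis Empty 𝕜 _) hbT hf hfr
  obtain ⟨B', -, -⟩ := exists_basis_sum hT' (Basis.empty _ : Basis Empty 𝕜 _) hbT' hf' hfr'
  have hcard := (finrank_eq_card_basis B).symm.trans (finrank_eq_card_basis B')
  simp only [Fintype.card_sum, Fintype.card_sigma, Fintype.card_fin, Nat.add_left_cancel_iff]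
    at hcard
  -- Domain and codomain coincide, so there are as many rows as columns; but each `L` block has one
  -- row more than columns.
  have hempty : IsEmpty (Fin L.length) := by
    by_contra hne
    rw [not_isEmpty_iff] at hne
    refine hcard.not_lt (Finset.sum_lt_sum_of_nonempty Finset.univ_nonempty fun i _ => ?_)
    have := hL _ (List.get_mem L i)
    omega
  refine ⟨l, hl, B.reindex ((Equiv.emptySum _ _).trans (Equiv.sumEmpty _ _)), fun i => ⟨?_, ?_⟩⟩
  · intro h
    simp [hB, hfx, hx0]
  · intro p h
    simp [hB, hfx, hx i p h]

/-- Collect nilpotent bases of `f - c` on the generalised eigenspaces, which span everything over an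
algebraically closed field. -/
theorem exists_jordan_basis [IsAlgClosed 𝕜] (f : End 𝕜 U) :
    ∃ l : List (𝕜 × ℕ), (∀ p ∈ l, 1 ≤ p.2) ∧
      ∃ b : Basis (Σ i : Fin l.length, Fin (l.get i).2) 𝕜 U,
        LinearMap.toMatrix b b f =
          Matrix.blockDiagonal' fun i => jordanBlock (l.get i).1 (l.get i).2 := by
  classical
  have hint : DirectSum.IsInternal fun c => f.maxGenEigenspace c :=
    DirectSum.isInternal_submodule_of_iSupIndep_of_iSup_eq_top f.independent_maxGenEigenspace
      (End.iSup_maxGenEigenspace_eq_top f)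
  choose l hl b hb using fun c =>
    exists_nilpotent_basis (End.isNilpotent_restrict_maxGenEigenspace_sub_algebraMap f c)
  let B := hint.collectedBasis b
  -- `c` ranges over the whole field, but each block has positive size and so contributes its own
  -- vector to the finite basis `B`.
  have hfin : Finite (Σ c, Fin (l c).length) := by
    have : Finite (Σ c, Σ i : Fin (l c).length, Fin ((l c).get i)) :=
      Module.Finite.finite_basis B
    refine Finite.of_injective (β := Σ c, Σ i : Fin (l c).length, Fin ((l c).get i))
      (fun x => ⟨x.1, x.2, 0, hl x.1 _ (List.get_mem _ _)⟩) ?_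
    rintro ⟨c, i⟩ ⟨c', i'⟩ h
    simp only [Sigma.mk.injEq] at h
    obtain ⟨rfl, h⟩ := h
    have h1 := congrArg Sigma.fst (eq_of_heq h)
    obtain rfl : i = i' := h1
    rfl
  obtain ⟨J, e, he, -⟩ := exists_list_equiv fun x : Σ c, Fin (l c).length =>
    (x.1, (l x.1).get x.2)
  let eJ : (Σ i : Fin J.length, Fin (J.get i).2) ≃
      Σ c, Σ i : Fin (l c).length, Fin ((l c).get i) :=
    (Equiv.sigmaCongr e fun i => finCongr (by rw [he])).trans
      (Equiv.sigmaAssoc fun c i => Fin ((l c).get i))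
  refine ⟨J, fun p hp => ?_, B.reindex eJ.symm, ?_⟩
  · obtain ⟨i, rfl⟩ := List.get_of_mem hp
    rw [he]
    exact hl _ _ (List.get_mem _ _)
  · have hval : ∀ i p (hp : p < (J.get i).2), B.reindex eJ.symm ⟨i, p, hp⟩ =
        b (e i).1 ⟨(e i).2, p, by rw [he] at hp; exact hp⟩ := by
      intro i p hp
      rw [Basis.reindex_apply]
      exact hint.collectedBasis_coe b ▸ rfl
    have hstep : ∀ c (y : f.maxGenEigenspace c), f y = c • (y : U) +
        ((f - algebraMap 𝕜 (End 𝕜 U) c).restrict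
          (End.mapsTo_maxGenEigenspace_of_comm (Algebra.mul_sub_algebraMap_commutes f c) c) y :
          U) := by
      intro c y
      change f y = c • (y : U) + (f y - c • (y : U))
      abel
    have hc : ∀ j, (J.get j).1 = (e j).1 := fun j => by rw [he]
    ext i ⟨j, q, hq⟩
    rw [LinearMap.toMatrix_apply, hval, hstep, blockDiagonal'_jordanBlock, hc]
    rcases q with _ | q
    · rw [(hb (e j).1 (e j).2).1, Submodule.coe_zero, add_zero, ← hval, map_smul,
        Basis.repr_self, Finsupp.smul_apply, Finsupp.single_apply]
      · simp [sigma_fin_ext_iff, ite_and, eq_comm]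
      · exact hq
    · rw [(hb (e j).1 (e j).2).2, ← hval, ← hval, map_add, map_smul, Basis.repr_self,
        Basis.repr_self, Finsupp.add_apply, Finsupp.smul_apply, Finsupp.single_apply,
        Finsupp.single_apply]
      · simp only [sigma_fin_ext_iff, ite_and, eq_comm, smul_eq_mul, mul_ite, mul_one, mul_zero,
          Nat.add_right_cancel_iff]
        split_ifs <;> simp
      · exact Nat.lt_of_succ_lt hq
      · exact hq

end Jordan

/-! ### Kronecker decompositions from full decompositions -/

section Predual

variable {𝕜 : Type*} [Field 𝕜] {U : Type*} [AddCommGroup U] [Module 𝕜 U]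
  [FiniteDimensional 𝕜 U] {ι : Type*} [Finite ι] [DecidableEq ι]

/-- Take the dual basis in the bidual and pull it back by reflexivity. -/
theorem exists_dualBasis_eq (β : Basis ι 𝕜 (Dual 𝕜 U)) : ∃ b : Basis ι 𝕜 U, b.dualBasis = β := by
  refine ⟨β.dualBasis.map (evalEquiv 𝕜 U).symm, ?_⟩
  have h : ∀ i j, β i ((β.dualBasis.map (evalEquiv 𝕜 U).symm) j) = if i = j then 1 else 0 := by
    intro i j
    rw [Basis.map_apply, apply_evalEquiv_symm_apply, Basis.dualBasis_apply_self]
  refine Basis.eq_of_apply_eq fun i => (β.dualBasis.map (evalEquiv 𝕜 U).symm).ext fun j => ?_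
  rw [h, Basis.dualBasis_apply_self]
  simp [eq_comm]

end Predual

/-! ### Matrices of dual maps -/

section Matrices

variable {𝕜 : Type*} [Field 𝕜] {M V : Type*} [AddCommGroup M] [Module 𝕜 M]
  [AddCommGroup V] [Module 𝕜 V] {m n : Type*} [Fintype m] [Fintype n] [DecidableEq n]

theorem strictlyEquivalent_toLin' (B : Basis n 𝕜 M) (B' : Basis m 𝕜 V) (E A : M →ₗ[𝕜] V) :
    StrictlyEquivalent E A (Matrix.toLin' (LinearMap.toMatrix B B' E))
      (Matrix.toLin' (LinearMap.toMatrix B B' A)) := by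
  refine ⟨B'.equivFun, B.equivFun.symm, ?_, ?_⟩ <;>
  · rw [← LinearMap.toMatrix'.injective.eq_iff, LinearMap.toMatrix'_toLin']
    ext i j
    rw [LinearMap.toMatrix_apply, LinearMap.toMatrix'_apply]
    simp

variable [DecidableEq m]

theorem toMatrix_dualMap (B : Basis n 𝕜 M) (B' : Basis m 𝕜 V) (E : M →ₗ[𝕜] V) :
    LinearMap.toMatrix B'.dualBasis B.dualBasis E.dualMap =
      (LinearMap.toMatrix B B' E).transpose :=
  LinearMap.toMatrix_transpose E

theorem strictlyEquivalent_dualMap_toLin' (B : Basis n 𝕜 M) (B' : Basis m 𝕜 V)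
    (E A : M →ₗ[𝕜] V) :
    StrictlyEquivalent E.dualMap A.dualMap
      (Matrix.toLin' (LinearMap.toMatrix B B' E).transpose)
      (Matrix.toLin' (LinearMap.toMatrix B B' A).transpose) := by
  rw [← toMatrix_dualMap, ← toMatrix_dualMap]
  exact strictlyEquivalent_toLin' _ _ _ _

/-- Transfers a block form of the dual system back to the system by transposition. The empty type
`ε` stands for the nilpotent blocks, which are absent from the dual of the stationary system. -/
theorem exists_predual_bases [FiniteDimensional 𝕜 M] [FiniteDimensional 𝕜 V]
    {ε : Type*} [Fintype ε] [DecidableEq ε] [IsEmpty ε] {ι ι' κ κ' : Type*}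
    [Fintype ι] [DecidableEq ι] [Fintype κ] [DecidableEq κ] [Fintype ι'] [DecidableEq ι']
    [Fintype κ'] [DecidableEq κ']
    (BV : Basis (ι ⊕ (ε ⊕ κ)) 𝕜 (Dual 𝕜 V)) (BM : Basis (ι' ⊕ (ε ⊕ κ')) 𝕜 (Dual 𝕜 M)) :
    ∃ (bM : Basis (ι' ⊕ κ') 𝕜 M) (bV : Basis (ι ⊕ κ) 𝕜 V),
      (∀ i, bM.coord (Sum.inl i) = BM (Sum.inl i)) ∧
      (∀ i, bM.coord (Sum.inr i) = BM (Sum.inr (Sum.inr i))) ∧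
      (∀ i, bV.coord (Sum.inl i) = BV (Sum.inl i)) ∧
      (∀ i, bV.coord (Sum.inr i) = BV (Sum.inr (Sum.inr i))) ∧
      ∀ (F : M →ₗ[𝕜] V) (X : Matrix ι' ι 𝕜) (P : Matrix ε ε 𝕜) (R : Matrix κ' κ 𝕜),
        LinearMap.toMatrix BV BM F.dualMap =
          Matrix.fromBlocks X 0 0 (Matrix.fromBlocks P 0 0 R) →
        LinearMap.toMatrix bM bV F = Matrix.fromBlocks X.transpose 0 0 R.transpose := by
  obtain ⟨bV, hbV⟩ := exists_dualBasis_eq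
    (BV.reindex (Equiv.sumCongr (Equiv.refl ι) (Equiv.emptySum ε κ)))
  obtain ⟨bM, hbM⟩ := exists_dualBasis_eq
    (BM.reindex (Equiv.sumCongr (Equiv.refl ι') (Equiv.emptySum ε κ')))
  refine ⟨bM, bV, fun i => ?_, fun i => ?_, fun i => ?_, fun i => ?_, fun F X P R h => ?_⟩
  · simp [← bM.coe_dualBasis, hbM]
  · simp [← bM.coe_dualBasis, hbM]
  · simp [← bV.coe_dualBasis, hbV]
  · simp [← bV.coe_dualBasis, hbV]
  · rw [← Matrix.transpose_transpose (LinearMap.toMatrix bM bV F), ← toMatrix_dualMap, hbM, hbV]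
    ext i j
    have hij := congrFun (congrFun h
      ((Equiv.sumCongr (Equiv.refl ι') (Equiv.emptySum ε κ')).symm j))
      ((Equiv.sumCongr (Equiv.refl ι) (Equiv.emptySum ε κ)).symm i)
    rw [LinearMap.toMatrix_apply] at hij
    rw [Matrix.transpose_apply, LinearMap.toMatrix_apply, Basis.reindex_apply,
      Basis.repr_reindex_apply, hij]
    rcases i with i | i <;> rcases j with j | j <;> simp

end Matrices

/-! ### Normal form of the dynamical part -/

section Dynamical

variable {𝕜 : Type*} [Field 𝕜] {M V : Type*} [AddCommGroup M] [Module 𝕜 M]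
  [AddCommGroup V] [Module 𝕜 V] [FiniteDimensional 𝕜 M] [FiniteDimensional 𝕜 V]

theorem EInfDual_injective (E A : M →ₗ[𝕜] V) : Function.Injective (EInfDual E A) :=
  LinearMap.dualMap_injective_of_surjective (EInf_surjective E A)

/-- Surjective because the second reduction is stationary, injective as a restriction of the dual of
a surjection. -/
theorem dynE_bijective (E A : M →ₗ[𝕜] V) : Function.Bijective (dynE E A) := by
  refine ⟨fun x y hxy => Subtype.ext (EInfDual_injective E A ?_), EInf_surjective _ _⟩
  exact congrArg Subtype.val hxy

/-- Bases of the spaces of the dynamical part in which it is `(I, Jᵀ)`. -/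
theorem exists_dyn_bases [IsAlgClosed 𝕜] (E A : M →ₗ[𝕜] V) :
    ∃ l : List (𝕜 × ℕ), (∀ p ∈ l, 1 ≤ p.2) ∧
      ∃ (b : Basis (Σ i : Fin l.length, Fin (l.get i).2) 𝕜 (dynDom E A))
        (b' : Basis (Σ i : Fin l.length, Fin (l.get i).2) 𝕜 (dynCod E A)),
        LinearMap.toMatrix b b' (dynE E A) = 1 ∧
        LinearMap.toMatrix b b' (dynA E A) =
          (Matrix.blockDiagonal' fun i => jordanBlock (l.get i).1 (l.get i).2).transpose := by
  let e := LinearEquiv.ofBijective (dynE E A) (dynE_bijective E A)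
  let f : End 𝕜 (dynDom E A) := e.symm.toLinearMap ∘ₗ dynA E A
  -- Using the dual of `f` makes the matrix of `f` equal to `Jᵀ`, so that the transposition back to
  -- `M^(∞)` and `V^(∞)` gives `J` itself.
  obtain ⟨l, hl, β, hβ⟩ := exists_jordan_basis f.dualMap
  obtain ⟨b, rfl⟩ := exists_dualBasis_eq (𝕜 := 𝕜) (U := dynDom E A) β
  refine ⟨l, hl, b, b.map e, ?_, ?_⟩
  · ext i j
    rw [LinearMap.toMatrix_apply]
    change (b.map e).repr (e (b j)) i = _
    simp [Matrix.one_apply, Finsupp.single_apply, eq_comm]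
  · rw [← hβ]
    rw [toMatrix_dualMap (𝕜 := 𝕜) (M := dynDom E A) (V := dynDom E A) b b f,
      Matrix.transpose_transpose]
    ext i j
    rw [LinearMap.toMatrix_apply, LinearMap.toMatrix_apply]
    rfl

end Dynamical

/-! ### Normal form of the totally reduced system -/

section Kronecker

variable {𝕜 : Type*} [Field 𝕜] [IsAlgClosed 𝕜] {M V : Type*} [AddCommGroup M] [Module 𝕜 M]
  [AddCommGroup V] [Module 𝕜 V] [FiniteDimensional 𝕜 M] [FiniteDimensional 𝕜 V]

/-- Bases of `M^(∞)` and `V^(∞)` made of the Jordan part and the blocks `L_kᵀ`. -/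
theorem exists_totallyReduced_bases {E A : M →ₗ[𝕜] V}
    (d : ReductionDecomposition (EInfDual E A) (AInfDual E A)) :
    ∃ (J : List (𝕜 × ℕ)) (L : List ℕ), (∀ p ∈ J, 1 ≤ p.2) ∧ (∀ k ∈ L, 1 ≤ k) ∧
      (∀ k ≥ 1, L.count k = betaMinus E A k) ∧
      StrictlyEquivalent (dynE E A).dualMap (dynA E A).dualMap
        (Matrix.toLin' (1 : Matrix (Σ i : Fin J.length, Fin (J.get i).2)
          (Σ i : Fin J.length, Fin (J.get i).2) 𝕜))
        (Matrix.toLin' (Matrix.blockDiagonal' fun i => jordanBlock (J.get i).1 (J.get i).2)) ∧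
      ∃ (bM : Basis ((Σ i : Fin J.length, Fin (J.get i).2) ⊕ (Σ i : Fin L.length, Fin (L.get i)))
          𝕜 (domInf E A))
        (bV : Basis ((Σ i : Fin J.length, Fin (J.get i).2) ⊕
          (Σ i : Fin L.length, Fin (L.get i - 1))) 𝕜 (codInf E A)),
        Set.range (fun i => bM.coord (Sum.inr i)) = d.basisV ∧
        Submodule.span 𝕜 (Set.range fun i => bM.coord (Sum.inl i)) = dynCod E A ∧
        Set.range (fun i => bV.coord (Sum.inr i)) = d.basisM ∧
        Submodule.span 𝕜 (Set.range fun i => bV.coord (Sum.inl i)) = dynDom E A ∧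
        LinearMap.toMatrix bM bV (EInf E A) = Matrix.fromBlocks 1 0 0
          (Matrix.blockDiagonal' fun i => (blockLE 𝕜 (L.get i)).transpose) ∧
        LinearMap.toMatrix bM bV (AInf E A) = Matrix.fromBlocks
          (Matrix.blockDiagonal' fun i => jordanBlock (J.get i).1 (J.get i).2) 0 0
          (Matrix.blockDiagonal' fun i => (blockLA 𝕜 (L.get i)).transpose) := by
  obtain ⟨J, hJ, b, b', hE, hA⟩ := exists_dyn_bases E A
  obtain ⟨ν, L, hν, hL, hcount, BM, BV, hBM, hBMr, hBV, hBVr, hBE, hBA⟩ := d.exists_bases b b'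
  -- Each `K^(k)` lies in the kernel of the injective map `E^(∞)*`, so the dual system has no
  -- nilpotent blocks.
  have hempty : IsEmpty (Σ i : Fin ν.length, Fin (ν.get i)) := by
    refine ⟨fun i => ?_⟩
    have hi := List.get_mem ν i.1
    generalize ν.get i.1 = k at hi
    obtain ⟨k, rfl⟩ := Nat.exists_eq_add_of_le' (hν k hi)
    have h1 := (hcount (k + 1) (hν _ hi)).1
    have h2 : d.K (k + 1) = ⊥ := by
      rw [eq_bot_iff, ← LinearMap.ker_eq_bot.2 (EInfDual_injective E A)]
      exact d.K_le_ker k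
    rw [← d.finrank_K, h2, finrank_bot] at h1
    exact List.count_eq_zero.1 h1 hi
  obtain ⟨bM, bV, hMl, hMr, hVl, hVr, hF⟩ := exists_predual_bases BM BV
  refine ⟨J, L, hJ, hL, fun k hk => (hcount k hk).2, ?_, bM, bV, ?_, ?_, ?_, ?_, ?_, ?_⟩
  · have h := strictlyEquivalent_dualMap_toLin' (𝕜 := 𝕜) (M := dynDom E A) (V := dynCod E A)
      b b' (dynE E A) (dynA E A)
    rwa [hE, hA, Matrix.transpose_one, Matrix.transpose_transpose] at h
  · rw [← hBVr]
    simp only [hMr]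
    ext v
    simp
  · simp only [hMl, hBV]
    exact span_range_coe_basis b'
  · rw [← hBMr]
    simp only [hVr]
    ext v
    simp
  · simp only [hVl, hBM]
    exact span_range_coe_basis b
  · rw [hF _ _ _ _ hBE, hE, Matrix.transpose_one, Matrix.blockDiagonal'_transpose]
  · rw [hF _ _ _ _ hBA, hA, Matrix.transpose_transpose, Matrix.blockDiagonal'_transpose]

end Kronecker

/-! ### Assembling the Kronecker decomposition -/

section Regrouping

/-- The rearrangement of a sum of four types. -/
def regroup (α β γ δ : Type*) : (α ⊕ δ) ⊕ (β ⊕ γ) ≃ α ⊕ (β ⊕ (γ ⊕ δ)) where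
  toFun := Sum.elim (Sum.elim Sum.inl fun x => Sum.inr (Sum.inr (Sum.inr x)))
    (Sum.elim (fun x => Sum.inr (Sum.inl x)) fun x => Sum.inr (Sum.inr (Sum.inl x)))
  invFun := Sum.elim (fun x => Sum.inl (Sum.inl x)) (Sum.elim (fun x => Sum.inr (Sum.inl x))
    (Sum.elim (fun x => Sum.inr (Sum.inr x)) fun x => Sum.inl (Sum.inr x)))
  left_inv := by rintro ((x | x) | (x | x)) <;> rfl
  right_inv := by rintro (x | x | x | x) <;> rfl

variable {𝕜 : Type*} [Field 𝕜] {M V : Type*} [AddCommGroup M] [Module 𝕜 M]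
  [AddCommGroup V] [Module 𝕜 V]

theorem toMatrix_regroup {a b c d a' b' c' d' : Type*} [Fintype a] [Fintype b] [Fintype c]
    [Fintype d] [Fintype a'] [Fintype b'] [Fintype c'] [Fintype d'] [DecidableEq a]
    [DecidableEq b] [DecidableEq c] [DecidableEq d]
    {B : Basis ((a ⊕ d) ⊕ (b ⊕ c)) 𝕜 M} {B' : Basis ((a' ⊕ d') ⊕ (b' ⊕ c')) 𝕜 V}
    {F : M →ₗ[𝕜] V} {X : Matrix a' a 𝕜} {P : Matrix b' b 𝕜} {Q : Matrix c' c 𝕜}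
    {R : Matrix d' d 𝕜} (h : LinearMap.toMatrix B B' F =
      Matrix.fromBlocks (Matrix.fromBlocks X 0 0 R) 0 0 (Matrix.fromBlocks P 0 0 Q)) :
    LinearMap.toMatrix (B.reindex (regroup a b c d)) (B'.reindex (regroup a' b' c' d')) F =
      Matrix.fromBlocks X 0 0 (Matrix.fromBlocks P 0 0 (Matrix.fromBlocks Q 0 0 R)) := by
  ext i j
  have hij := congrFun (congrFun h ((regroup a' b' c' d').symm i)) ((regroup a b c d).symm j)
  rw [LinearMap.toMatrix_apply] at hij
  rw [LinearMap.toMatrix_apply, Basis.reindex_apply, Basis.repr_reindex_apply, hij]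
  rcases i with i | i | i | i <;> rcases j with j | j | j | j <;> rfl

theorem FullDecomposition.exists_kroneckerDecomposition [IsAlgClosed 𝕜] [FiniteDimensional 𝕜 M]
    [FiniteDimensional 𝕜 V] {E A : M →ₗ[𝕜] V} (d : FullDecomposition E A) :
    ∃ κ : KroneckerDecomposition E A, κ.IsRegroupingOf d ∧
      (∀ k ≥ 1, κ.blocks.nil.count k = alpha E A k ∧ κ.blocks.L.count k = betaPlus E A k ∧
        κ.blocks.LT.count k = betaMinus E A k) ∧
      StrictlyEquivalent (dynE E A).dualMap (dynA E A).dualMap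
        (Matrix.toLin' (1 : Matrix κ.blocks.DynIdx κ.blocks.DynIdx 𝕜))
        (Matrix.toLin' κ.blocks.matJ) := by
  obtain ⟨J, LT, hJ, hLT, hLTc, hdyn, bM, bV, hMr, hMl, hVr, hVl, hE, hA⟩ :=
    exists_totallyReduced_bases d.second
  obtain ⟨ν, L, hν, hL, hcount, BM, BV, hBM, hBMr, hBV, hBVr, hBE, hBA⟩ :=
    d.first.exists_bases bM bV
  rw [hE] at hBE
  rw [hA] at hBA
  refine ⟨⟨⟨J, ν, L, LT, hJ, hν, hL, hLT⟩, BM.reindex (regroup _ _ _ _),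
    BV.reindex (regroup _ _ _ _), toMatrix_regroup hBE, toMatrix_regroup hBA⟩,
    ⟨?_, ?_, ⟨bM, ?_, hMr, hMl⟩, ⟨bV, ?_, hVr, hVl⟩⟩,
    fun k hk => ⟨(hcount k hk).1, (hcount k hk).2, hLTc k hk⟩, hdyn⟩
  · rw [← hBMr]
    congr 1
    funext i
    rw [Basis.reindex_apply]
    rcases i with i | i <;> rfl
  · rw [← hBVr]
    congr 1
    funext i
    rw [Basis.reindex_apply]
    rcases i with i | i <;> rfl
  · intro i
    rw [← hBM, Basis.reindex_apply]
    rcases i with i | i <;> rfl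
  · intro i
    rw [← hBV, Basis.reindex_apply]
    rcases i with i | i <;> rfl

theorem nonempty_fullDecomposition [FiniteDimensional 𝕜 M] [FiniteDimensional 𝕜 V]
    (E A : M →ₗ[𝕜] V) : Nonempty (FullDecomposition E A) := by
  obtain ⟨d⟩ := nonempty_reductionDecomposition E A
  obtain ⟨d'⟩ := nonempty_reductionDecomposition (EInfDual E A) (AInfDual E A)
  exact ⟨⟨d, d'⟩⟩

end Regrouping

/-! ### Strict equivalence of Kronecker forms -/

section Blocks

variable {𝕜 : Type*} [Field 𝕜]

theorem strictlyEquivalent_fromBlocks {m n m' n' : Type*} [Fintype n] [Fintype n'] [DecidableEq n]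
    [DecidableEq n'] [Finite m] [Finite m'] (X Y : Matrix m n 𝕜) (X' Y' : Matrix m' n' 𝕜) :
    StrictlyEquivalent (Matrix.toLin' (Matrix.fromBlocks X 0 0 X'))
      (Matrix.toLin' (Matrix.fromBlocks Y 0 0 Y'))
      ((Matrix.toLin' X).prodMap (Matrix.toLin' X'))
      ((Matrix.toLin' Y).prodMap (Matrix.toLin' Y')) := by
  refine ⟨LinearEquiv.sumArrowLequivProdArrow m m' 𝕜 𝕜,
    (LinearEquiv.sumArrowLequivProdArrow n n' 𝕜 𝕜).symm, ?_, ?_⟩ <;>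
  · refine LinearMap.ext fun x => ?_
    ext i <;> simp [Matrix.mulVec, dotProduct, Matrix.fromBlocks] <;> rfl

theorem StrictlyEquivalent.fromBlocks {m n m' n' r s r' s' : Type*} [Fintype n] [Fintype n']
    [DecidableEq n] [DecidableEq n'] [Finite m] [Finite m'] [Fintype s] [Fintype s']
    [DecidableEq s] [DecidableEq s'] [Finite r] [Finite r']
    {X Y : Matrix m n 𝕜} {X' Y' : Matrix m' n' 𝕜} {Z W : Matrix r s 𝕜} {Z' W' : Matrix r' s' 𝕜}
    (h : StrictlyEquivalent (Matrix.toLin' X) (Matrix.toLin' Y) (Matrix.toLin' Z)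
      (Matrix.toLin' W))
    (h' : StrictlyEquivalent (Matrix.toLin' X') (Matrix.toLin' Y') (Matrix.toLin' Z')
      (Matrix.toLin' W')) :
    StrictlyEquivalent (Matrix.toLin' (Matrix.fromBlocks X 0 0 X'))
      (Matrix.toLin' (Matrix.fromBlocks Y 0 0 Y'))
      (Matrix.toLin' (Matrix.fromBlocks Z 0 0 Z'))
      (Matrix.toLin' (Matrix.fromBlocks W 0 0 W')) :=
  (strictlyEquivalent_fromBlocks X Y X' Y').trans
    ((h.prodMap h').trans (strictlyEquivalent_fromBlocks Z W Z' W').symm)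

theorem strictlyEquivalent_submatrix {m n m' n' : Type*} [Fintype n] [Fintype n'] [DecidableEq n]
    [DecidableEq n'] (X Y : Matrix m n 𝕜) (e : m' ≃ m) (f : n' ≃ n) :
    StrictlyEquivalent (Matrix.toLin' X) (Matrix.toLin' Y) (Matrix.toLin' (X.submatrix e f))
      (Matrix.toLin' (Y.submatrix e f)) := by
  refine ⟨LinearEquiv.funCongrLeft 𝕜 𝕜 e, LinearEquiv.funCongrLeft 𝕜 𝕜 f.symm, ?_, ?_⟩ <;>
  · refine LinearMap.ext fun x => ?_
    ext i
    simp [Matrix.mulVec, dotProduct, LinearMap.funLeft_apply, ← Equiv.sum_comp f]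

theorem card_get_eq (l : List ℕ) (a : ℕ) :
    Fintype.card {i : Fin l.length // l.get i = a} = l.count a := by
  rw [Fintype.card_subtype]
  exact Fin.card_filter_univ_eq_vector_get_eq_count a ⟨l, rfl⟩

theorem exists_equiv_of_count_eq {l l' : List ℕ} (h : ∀ a, l.count a = l'.count a) :
    ∃ e : Fin l.length ≃ Fin l'.length, ∀ i, l'.get (e i) = l.get i := by
  have e : ∀ a, {i : Fin l.length // l.get i = a} ≃ {i : Fin l'.length // l'.get i = a} :=
    fun a => Fintype.equivOfCardEq (by rw [card_get_eq, card_get_eq, h])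
  exact ⟨Equiv.ofFiberEquiv e, Equiv.ofFiberEquiv_map e⟩

/-- Lists with equal multiplicities differ by a permutation of the blocks, which permutes rows and
columns simultaneously for both matrices of the pair. -/
theorem StrictlyEquivalent.blockDiagonal'_of_count_eq {l l' : List ℕ}
    (h : ∀ a, l.count a = l'.count a) {r c : ℕ → ℕ} (X Y : ∀ k, Matrix (Fin (r k)) (Fin (c k)) 𝕜) :
    StrictlyEquivalent
      (Matrix.toLin' (Matrix.blockDiagonal' fun i : Fin l'.length => X (l'.get i)))
      (Matrix.toLin' (Matrix.blockDiagonal' fun i : Fin l'.length => Y (l'.get i)))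
      (Matrix.toLin' (Matrix.blockDiagonal' fun i : Fin l.length => X (l.get i)))
      (Matrix.toLin' (Matrix.blockDiagonal' fun i : Fin l.length => Y (l.get i))) := by
  obtain ⟨e, he⟩ := exists_equiv_of_count_eq h
  let f : ∀ r : ℕ → ℕ, (Σ i : Fin l.length, Fin (r (l.get i))) ≃
      Σ i : Fin l'.length, Fin (r (l'.get i)) := fun r =>
    Equiv.sigmaCongr e fun i => finCongr (by rw [he])
  have key : ∀ X : ∀ k, Matrix (Fin (r k)) (Fin (c k)) 𝕜,
      (Matrix.blockDiagonal' fun i : Fin l.length => X (l.get i)) =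
        (Matrix.blockDiagonal' fun i : Fin l'.length => X (l'.get i)).submatrix (f r) (f c) := by
    intro X
    ext ⟨i, p⟩ ⟨j, q⟩
    change _ = Matrix.blockDiagonal' (fun i : Fin l'.length => X (l'.get i))
      ⟨e i, finCongr _ p⟩ ⟨e j, finCongr _ q⟩
    by_cases hij : i = j
    · subst hij
      rw [Matrix.blockDiagonal'_apply_eq, Matrix.blockDiagonal'_apply_eq]
      have : ∀ {a b : ℕ} (h : a = b) (p : Fin (r a)) (q : Fin (c a)),
          X a p q = X b (finCongr (by rw [h]) p) (finCongr (by rw [h]) q) := by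
        rintro a _ rfl p q
        rfl
      exact this (he i).symm p q
    · rw [Matrix.blockDiagonal'_apply_ne _ _ _ hij,
        Matrix.blockDiagonal'_apply_ne _ _ _ (e.injective.ne hij)]
  rw [key X, key Y]
  exact strictlyEquivalent_submatrix _ _ _ _

theorem KroneckerBlocks.strictlyEquivalent {b b' : KroneckerBlocks 𝕜}
    (hJ : StrictlyEquivalent (Matrix.toLin' (1 : Matrix b.DynIdx b.DynIdx 𝕜))
      (Matrix.toLin' b.matJ) (Matrix.toLin' (1 : Matrix b'.DynIdx b'.DynIdx 𝕜))
      (Matrix.toLin' b'.matJ))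
    (hnil : ∀ k, b'.nil.count k = b.nil.count k) (hL : ∀ k, b'.L.count k = b.L.count k)
    (hLT : ∀ k, b'.LT.count k = b.LT.count k) :
    StrictlyEquivalent (Matrix.toLin' b.matE) (Matrix.toLin' b.matA) (Matrix.toLin' b'.matE)
      (Matrix.toLin' b'.matA) :=
  hJ.fromBlocks ((StrictlyEquivalent.blockDiagonal'_of_count_eq hnil (r := id) (c := id)
    (blockNE 𝕜) (blockNA 𝕜)).fromBlocks
    ((StrictlyEquivalent.blockDiagonal'_of_count_eq hL (r := id) (c := fun k => k - 1)
      (blockLE 𝕜) (blockLA 𝕜)).fromBlocks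
      (StrictlyEquivalent.blockDiagonal'_of_count_eq hLT (r := fun k => k - 1) (c := id)
        (fun k => (blockLE 𝕜 k).transpose) fun k => (blockLA 𝕜 k).transpose)))

theorem KroneckerDecomposition.strictlyEquivalent {M V : Type*} [AddCommGroup M] [Module 𝕜 M]
    [AddCommGroup V] [Module 𝕜 V] {E A : M →ₗ[𝕜] V} (κ : KroneckerDecomposition E A) :
    StrictlyEquivalent E A (Matrix.toLin' κ.blocks.matE) (Matrix.toLin' κ.blocks.matA) := by
  rw [← κ.toMatrix_E, ← κ.toMatrix_A]
  exact strictlyEquivalent_toLin' _ _ _ _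

end Blocks

/-! ### Classification up to strict equivalence -/

section Classification

variable {𝕜 : Type*} [Field 𝕜] [IsAlgClosed 𝕜] {M V M₂ V₂ : Type*}
  [AddCommGroup M] [Module 𝕜 M] [FiniteDimensional 𝕜 M]
  [AddCommGroup V] [Module 𝕜 V] [FiniteDimensional 𝕜 V]
  [AddCommGroup M₂] [Module 𝕜 M₂] [FiniteDimensional 𝕜 M₂]
  [AddCommGroup V₂] [Module 𝕜 V₂] [FiniteDimensional 𝕜 V₂]

theorem strictlyEquivalent_iff (E A : M →ₗ[𝕜] V) (E₂ A₂ : M₂ →ₗ[𝕜] V₂) :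
    StrictlyEquivalent E A E₂ A₂ ↔
      (∀ k ≥ 1, alpha E A k = alpha E₂ A₂ k ∧ betaPlus E A k = betaPlus E₂ A₂ k ∧
        betaMinus E A k = betaMinus E₂ A₂ k) ∧
      StrictlyEquivalent (dynE E A) (dynA E A) (dynE E₂ A₂) (dynA E₂ A₂) := by
  constructor
  · intro h
    refine ⟨fun k hk => ?_, h.totallyReduced.dualMap.totallyReduced⟩
    obtain ⟨k, rfl⟩ := Nat.exists_eq_add_of_le' hk
    exact ⟨h.alpha_succ_eq k, h.betaPlus_succ_eq k, h.betaMinus_succ_eq k⟩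
  · rintro ⟨h, hdyn⟩
    obtain ⟨d⟩ := nonempty_fullDecomposition E A
    obtain ⟨d₂⟩ := nonempty_fullDecomposition E₂ A₂
    obtain ⟨κ, -, hκ, hJ⟩ := d.exists_kroneckerDecomposition
    obtain ⟨κ₂, -, hκ₂, hJ₂⟩ := d₂.exists_kroneckerDecomposition
    -- The defects control the multiplicities only for `k ≥ 1`; size `0` does not occur in either
    -- list.
    have count : ∀ {l l' : List ℕ}, (∀ k ∈ l, 1 ≤ k) → (∀ k ∈ l', 1 ≤ k) →
        (∀ k ≥ 1, l'.count k = l.count k) → ∀ k, l'.count k = l.count k := by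
      intro l l' hl hl' hc k
      rcases Nat.eq_zero_or_pos k with rfl | hk
      · rw [List.count_eq_zero.2 fun h0 => absurd (hl _ h0) (by omega),
          List.count_eq_zero.2 fun h0 => absurd (hl' _ h0) (by omega)]
      · exact hc k hk
    have hdual : StrictlyEquivalent (dynE E A).dualMap (dynA E A).dualMap (dynE E₂ A₂).dualMap
        (dynA E₂ A₂).dualMap :=
      StrictlyEquivalent.dualMap (𝕜 := 𝕜) (M₁ := dynDom E A) (V₁ := dynCod E A)
        (M₂ := dynDom E₂ A₂) (V₂ := dynCod E₂ A₂) hdyn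
    refine κ.strictlyEquivalent.trans ((KroneckerBlocks.strictlyEquivalent
      (hJ.symm.trans (hdual.trans hJ₂)) ?_ ?_ ?_).trans κ₂.strictlyEquivalent.symm)
    · exact count κ.blocks.nil_pos κ₂.blocks.nil_pos fun k hk => by
        rw [(hκ k hk).1, (hκ₂ k hk).1, (h k hk).1]
    · exact count κ.blocks.L_pos κ₂.blocks.L_pos fun k hk => by
        rw [(hκ k hk).2.1, (hκ₂ k hk).2.1, (h k hk).2.1]
    · exact count κ.blocks.LT_pos κ₂.blocks.LT_pos fun k hk => by
        rw [(hκ k hk).2.2, (hκ₂ k hk).2.2, (h k hk).2.2]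

end Classification

end Pencil

theorem theorem8p5 {𝕜 : Type*} [Field 𝕜] [IsAlgClosed 𝕜] {M V M₂ V₂ : Type*}
    [AddCommGroup M] [Module 𝕜 M] [FiniteDimensional 𝕜 M]
    [AddCommGroup V] [Module 𝕜 V] [FiniteDimensional 𝕜 V]
    [AddCommGroup M₂] [Module 𝕜 M₂] [FiniteDimensional 𝕜 M₂]
    [AddCommGroup V₂] [Module 𝕜 V₂] [FiniteDimensional 𝕜 V₂]
    (E A : M →ₗ[𝕜] V) (E₂ A₂ : M₂ →ₗ[𝕜] V₂) :
    Nonempty (Pencil.FullDecomposition E A) ∧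
    (∀ d : Pencil.FullDecomposition E A, ∃ κ : Pencil.KroneckerDecomposition E A,
      κ.IsRegroupingOf d ∧
      (∀ k ≥ 1, κ.blocks.nil.count k = Pencil.alpha E A k ∧
        κ.blocks.L.count k = Pencil.betaPlus E A k ∧
        κ.blocks.LT.count k = Pencil.betaMinus E A k) ∧
      Pencil.StrictlyEquivalent (Pencil.dynE E A).dualMap (Pencil.dynA E A).dualMap
        (Matrix.toLin' (1 : Matrix κ.blocks.DynIdx κ.blocks.DynIdx 𝕜))
        (Matrix.toLin' κ.blocks.matJ)) ∧
    (Pencil.StrictlyEquivalent E A E₂ A₂ ↔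
      (∀ k ≥ 1, Pencil.alpha E A k = Pencil.alpha E₂ A₂ k ∧
        Pencil.betaPlus E A k = Pencil.betaPlus E₂ A₂ k ∧
        Pencil.betaMinus E A k = Pencil.betaMinus E₂ A₂ k) ∧
      Pencil.StrictlyEquivalent (Pencil.dynE E A) (Pencil.dynA E A)
        (Pencil.dynE E₂ A₂) (Pencil.dynA E₂ A₂)) := by
  exact ⟨Pencil.nonempty_fullDecomposition E A,
    fun d => d.exists_kroneckerDecomposition, Pencil.strictlyEquivalent_iff E A E₂ A₂⟩
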